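/- Let $\Omega\subset\mathbb C^n$ be a bounded pseudo-convex domain with smooth boundary, let $0<s\le 1$, and let $\rho$ be a smooth defining function of $\Omega$ on a neighbourhood $U$ of $\overline\Omega$ (so $\Omega=\{z\in U:\rho(z)<0\}$ and $\nabla\rho\neq0$ on $\partial\Omega$) such that $-(-\rho)^s$ is strictly plurisubharmonic in $\Omega$. For a function $h$ on $\mathbb C^m$ put $$\widetilde\Omega=\{(z,w)\in U\times\mathbb C^m:\ \rho(z)+h(w)<0\}.$$ The order $\mathrm{ord}_0(g)$ of a smooth map $g$ at the origin is the smallest order of a partial derivative of $g$ that does not vanish at $0$ ($\infty$ if there is none). The type at a point $z_0$ of a smooth real function $k$ defined near $z_0\in\mathbb C^d$ is $$\mathrm{typ}_{z_0}(k)=\sup_\varphi\frac{\mathrm{ord}_0\big(k(z_0+\varphi)\big)}{\mathrm{ord}_0(\varphi)},$$ the supremum being over all non-zero holomorphic maps $\varphi$ from the unit disc to $\mathbb C^d$ with $\varphi(0)=0$; $k$ is of finite type at $z_0$ if this is finite. The boundary of a domain is of finite type $\tau$ at a smooth boundary point $p$ if $\tau=\mathrm{typ}_p(r)<\infty$ for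 a smooth local defining function $r$ of the domain near $p$ (the value is independent of $r$). A domain with smooth boundary is pseudo-convex (strictly pseudo-convex at $p$) if the Levi form of a local defining function is non-negative on the complex tangent space at every boundary point (positive definite on the complex tangent space at $p$). Call a smooth function $h\ge0$ on $\mathbb C^m$ admissible if $h(w)=0\Leftrightarrow w=0$, $\nabla h(w)\ne0$ for $w\neq0$, and $h(w)\to+\infty$ as $|w|\to\infty$. (1) (Condition I) Let $h$ be admissible and suppose that for some $s'\in[0,s)$ the function $h^{s'}$ is plurisubharmonic, in the sense that $i\partial\bar\partial h\ge i\frac{1-s'}{h}\,\partial h\wedge\bar\partial h$ outside the origin (for $s'=0$: $\log h$ is plurisubharmonic). (a) If $z^0\in\partial\Omega$, $\partial\Omega$ is of finite type $\tau$ at $z^0$ and $h$ is of finite type at the origin, then $\partial\widetilde\Omega$ is of finite type $\max(\tau,\mathrm{typ}_0(h))$ at $(z^0,0)$. (b) If $h$ is strictly plurisubharmonic on $\mathbb C^m\setminus\{0\}$, then $\partial\widetilde\Omega$ is strictly pseudo-convex at every boundary point $(z^0,w^0)$ with $w^0\neq0$. (2) (Condition II) Let $h(w)=\sum_{i=1}^p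 h_i(w_i)$, $w=(w_1,\dots,w_p)$, $w_i\in\mathbb C^{m_i}$, $m_i\ge1$, where each $h_i$ is admissible and plurisubharmonic on $\mathbb C^{m_i}$, strictly plurisubharmonic outside the origin, and of finite type at the origin, and $\log h_i$ is plurisubharmonic. Then $\widetilde\Omega$ is pseudo-convex, and at every $(z^0,w^0)\in\partial\widetilde\Omega$ with $w^0\ne0$: (a) if $w^0_i=0$ for some $i$, then $\partial\widetilde\Omega$ is of finite type $\max_{i:\,w_i^0=0}\mathrm{typ}_0(h_i)$ at $(z^0,w^0)$; (b) if $w_i^0\neq0$ for all $i$, then $\partial\widetilde\Omega$ is strictly pseudo-convex at $(z^0,w^0)$. -/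

import Mathlib

open Set Filter Topology
open scoped ENNReal ContDiff

noncomputable section

namespace Hartogs

/-- The complex Euclidean space `ℂⁿ`. -/
abbrev Cn (n : ℕ) : Type := EuclideanSpace ℂ (Fin n)

section General

variable {V : Type*} [NormedAddCommGroup V] [NormedSpace ℂ V]

/-- The Levi form `⟨∂∂̄f(z); t, t̄⟩ = ∑ (∂²f/∂z_j∂z̄_k)(z) t_j t̄_k` of a real function, written
through the real second derivative: a quarter of the Laplacian of `ζ ↦ f (z + ζ t)` at `0`. -/
def levi (f : V → ℝ) (z t : V) : ℝ :=
  (fderiv ℝ (fderiv ℝ f) z t t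
    + fderiv ℝ (fderiv ℝ f) z (Complex.I • t) (Complex.I • t)) / 4

/-- `f` is of class `C²` and plurisubharmonic on the open set `W`. -/
def IsPSHOn (f : V → ℝ) (W : Set V) : Prop :=
  ContDiffOn ℝ 2 f W ∧ ∀ z ∈ W, ∀ t : V, 0 ≤ levi f z t

/-- `f` is of class `C²` and strictly plurisubharmonic on the open set `W`. -/
def IsStrictPSHOn (f : V → ℝ) (W : Set V) : Prop :=
  ContDiffOn ℝ 2 f W ∧ ∀ z ∈ W, ∀ t : V, t ≠ 0 → 0 < levi f z t

/-- The vector `t` satisfies `⟨∂r(p), t⟩ = ∑ (∂r/∂z_j)(p) t_j = 0`, that is, both `t` and `i t` are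
tangent to the level set of `r` at `p`. -/
def IsComplexTangent (r : V → ℝ) (p t : V) : Prop :=
  fderiv ℝ r p t = 0 ∧ fderiv ℝ r p (Complex.I • t) = 0

/-- `r` is a smooth defining function of `Ω` in a neighbourhood of the boundary point `p`. -/
def IsLocalDefiningFunction (Ω : Set V) (p : V) (r : V → ℝ) : Prop :=
  ∃ W : Set V, IsOpen W ∧ p ∈ W ∧ ContDiffOn ℝ ∞ r W ∧ (∀ x ∈ W, x ∈ Ω ↔ r x < 0) ∧
    r p = 0 ∧ fderiv ℝ r p ≠ 0

/-- `Ω` has smooth boundary and is (Levi) pseudo-convex: at every boundary point the Levi form of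
a defining function is non-negative on the complex tangent space (this does not depend on the
defining function). -/
def IsPseudoconvex (Ω : Set V) : Prop :=
  ∀ p ∈ frontier Ω, ∃ r : V → ℝ, IsLocalDefiningFunction Ω p r ∧
    ∀ t : V, IsComplexTangent r p t → 0 ≤ levi r p t

/-- `∂Ω` is smooth near `p` and strictly pseudo-convex at `p`. -/
def IsStrictPseudoconvexAt (Ω : Set V) (p : V) : Prop :=
  ∃ r : V → ℝ, IsLocalDefiningFunction Ω p r ∧
    ∀ t : V, IsComplexTangent r p t → t ≠ 0 → 0 < levi r p t

/-- The order at the origin of a function of one complex (two real) variables: the smallest order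
of a non-vanishing derivative at `0`, and `∞` if all derivatives vanish there. -/
def ord₀ {F : Type*} [NormedAddCommGroup F] [NormedSpace ℝ F] (g : ℂ → F) : ℕ∞ :=
  ⨅ (k : ℕ) (_ : iteratedFDeriv ℝ k g 0 ≠ 0), (k : ℕ∞)

/-- Non-zero holomorphic maps `φ` of the unit disc into `V` with `φ(0) = 0`. -/
def IsDisc (φ : ℂ → V) : Prop :=
  DifferentiableOn ℂ φ (Metric.ball 0 1) ∧ φ 0 = 0 ∧ ∃ ζ ∈ Metric.ball (0 : ℂ) 1, φ ζ ≠ 0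

/-- The type `typ_z(k)` of a function `k` at the point `z`: the supremum of
`ord₀ (k(z + φ)) / ord₀ φ` over all non-zero holomorphic discs `φ` with `φ(0) = 0`. -/
def typ (k : V → ℝ) (z : V) : ℝ≥0∞ :=
  ⨆ (φ : ℂ → V) (_ : IsDisc φ),
    (ord₀ (fun ζ => k (z + φ ζ)) : ℝ≥0∞) / (ord₀ φ : ℝ≥0∞)

/-- `∂Ω` is of finite (D'Angelo) type `τ` at the boundary point `p`: the type of a defining
function at `p` is `τ < ∞` (the value does not depend on the defining function). -/
def IsOfFiniteType (Ω : Set V) (p : V) (τ : ℝ≥0∞) : Prop :=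
  τ < ⊤ ∧ ∃ r : V → ℝ, IsLocalDefiningFunction Ω p r ∧ typ r p = τ

/-- `Ω` is a smoothly bounded pseudo-convex domain. -/
structure IsSmoothBoundedPseudoconvexDomain (Ω : Set V) : Prop where
  isOpen : IsOpen Ω
  isConnected : IsConnected Ω
  isBounded : Bornology.IsBounded Ω
  pseudoconvex : IsPseudoconvex Ω

/-- `ρ` is a smooth defining function of `Ω`, defined on the open neighbourhood `U` of the closure
of `Ω` (possibly the whole space). -/
structure IsDefiningFunction (Ω U : Set V) (ρ : V → ℝ) : Prop where
  isOpen : IsOpen U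
  closure_subset : closure Ω ⊆ U
  smooth : ContDiffOn ℝ ∞ ρ U
  eq : Ω = {z ∈ U | ρ z < 0}
  gradient : ∀ z ∈ frontier Ω, fderiv ℝ ρ z ≠ 0

/-- The function `-(-ρ)^s` is strictly plurisubharmonic in `Ω`, where `0 < s ≤ 1`. -/
structure IsDiederichFornaess (Ω : Set V) (ρ : V → ℝ) (s : ℝ) : Prop where
  pos : 0 < s
  le_one : s ≤ 1
  strictPSH : IsStrictPSHOn (fun z => -(-ρ z) ^ s) Ω

/-- `h` is smooth, non-negative, vanishes exactly at `0`, has no critical point other than `0` and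
tends to `+∞` at infinity. -/
structure IsAdmissible (h : V → ℝ) : Prop where
  smooth : ContDiff ℝ ∞ h
  nonneg : ∀ w, 0 ≤ h w
  eq_zero_iff : ∀ w, h w = 0 ↔ w = 0
  gradient : ∀ w, w ≠ 0 → fderiv ℝ h w ≠ 0
  tendsto : Tendsto h (cocompact V) atTop

/-- The function `h^σ` is plurisubharmonic, with the usual convention that for `σ = 0` this means
that `log h` is plurisubharmonic; that is, `i∂∂̄h ≥ i (1 - σ)/h ∂h ∧ ∂̄h`. As `h` has its minimum
`0` at the origin, there is nothing to require there. -/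
def PowerIsPSH (h : V → ℝ) (σ : ℝ) : Prop :=
  if σ = 0 then IsPSHOn (fun w => Real.log (h w)) {0}ᶜ
  else IsPSHOn (fun w => h w ^ σ) {0}ᶜ

/-- Condition I on `h`, for the exponent `s` of the Diederich-Fornæss defining function. -/
structure ConditionI (s : ℝ) (h : V → ℝ) : Prop where
  admissible : IsAdmissible h
  psh : ∃ s' : ℝ, 0 ≤ s' ∧ s' < s ∧ PowerIsPSH h s'

end General

/-- Condition II on the summands `h_i` of `h(w) = ∑ h_i(w_i)`, `w_i ∈ ℂ^{m_i}`, `m_i ≥ 1`. -/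
structure ConditionII {p : ℕ} {m : Fin p → ℕ} (h : ∀ i, Cn (m i) → ℝ) : Prop where
  dim_pos : ∀ i, 1 ≤ m i
  admissible : ∀ i, IsAdmissible (h i)
  psh : ∀ i, IsPSHOn (h i) univ
  log_psh : ∀ i, IsPSHOn (fun w => Real.log (h i w)) {0}ᶜ
  strictPSH : ∀ i, IsStrictPSHOn (h i) {0}ᶜ
  finiteType : ∀ i, typ (h i) 0 < ⊤

/-- The function `h(w) = ∑ h_i(w_i)` on `∏ ℂ^{m_i}`. -/
def sumFun {p : ℕ} {m : Fin p → ℕ} (h : ∀ i, Cn (m i) → ℝ) (w : ∀ i, Cn (m i)) : ℝ :=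
  ∑ i, h i (w i)

/-- The Hartogs domain `Ω̃ = {(z, w) : ρ(z) + h(w) < 0}` (`ρ` being defined on `U`). -/
def tilde {E F : Type*} (U : Set E) (ρ : E → ℝ) (h : F → ℝ) : Set (E × F) :=
  {q | q.1 ∈ U ∧ ρ q.1 + h q.2 < 0}

end Hartogs

end

open Asymptotics

namespace Hartogs

/-! ### Orders of vanishing through growth at the origin -/

section Order

/-! Write `L` for the Levi form and `∂` for the (1,0)-differential. Plurisubharmonicity of `-(-ρ)^s`
and of `h^σ` is a pair of curvature inequalities: `-ρ·Lρ > -(1-s)|∂ρ|²` on nonzero vectors inside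
`Ω`, and `h·Lh ≥ (1-σ)|∂h|²`. At a boundary point with `h > 0` one has `-ρ = h`, and on a complex
tangent vector `|∂ρ| = |∂h|`. Adding the two gives `h·(Lρ + Lh) > (s-σ)|∂h|² ≥ 0` unless the
`z`-component vanishes, in which case `Lh` alone decides (`levi_add_levi_pos`). Where `h = 0`, the
Levi form of `ρ` is a limit of its values inside `Ω` (`levi_nonneg_of_mem_closure`). Condition II is
the case `σ = 0`: Cauchy-Schwarz transfers `|∂h_i|² ≤ h_i·Lh_i` to the sum.

For the types, the lower bounds come from discs lying in a single factor. The upper bounds say that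
there is no cancellation: along a disc the defining function is `g = f + b`, with `b ≥ 0`, and `g =
O(|ζ|^M)` must force `b = O(|ζ|^M)`. This is proved one order at a time. The curvature inequality
for `b` bounds `|∂b|²`, multiplied by a power of `b`, by terms containing `g`, and the orders fall
half a unit short of the goal. Since smooth functions have integral order, the half unit is
recovered (`isBigO_of_sq_isBigO`).

In (1) the part `f` is `ρ` along the disc, and the gap `s - σ > 0` gives the estimate
(`isBigO_of_add_isBigO_of_power`). In (2) the variable `z` and the components with `w_i ≠ 0` are put
together: their part of the defining function is strictly pseudo-convex at the base point, and `b`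
collects the other components (`isBigO_of_add_isBigO_of_strict`). Strictness also bounds the contact
in these directions by twice the order of the disc, which is harmless because each `typ_0(h_i)` is
at least 2 (`two_le_typ`). -/

theorem isBigO_norm_pow_mono {F : Type*} [NormedAddCommGroup F] {f : ℂ → F} {M N : ℕ}
    (hf : f =O[𝓝 0] fun ζ : ℂ => ‖ζ‖ ^ M) (h : N ≤ M) : f =O[𝓝 0] fun ζ : ℂ => ‖ζ‖ ^ N := by
  refine hf.trans (IsBigO.of_bound 1 ?_)
  filter_upwards [Metric.ball_mem_nhds (0 : ℂ) one_pos] with ζ hζ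
  rw [mem_ball_zero_iff] at hζ
  simp only [norm_pow, norm_norm, one_mul]
  exact pow_le_pow_of_le_one (norm_nonneg _) hζ.le h

theorem isLittleO_norm_pow_succ {N : ℕ} :
    (fun ζ : ℂ => ‖ζ‖ ^ (N + 1)) =o[𝓝 0] fun ζ : ℂ => ‖ζ‖ ^ N := by
  have h : (fun ζ : ℂ => ‖ζ‖) =o[𝓝 0] fun _ => (1 : ℝ) := by
    rw [isLittleO_one_iff]
    simpa using (continuous_norm (E := ℂ)).tendsto 0
  simpa [pow_succ] using (isBigO_refl (fun ζ : ℂ => ‖ζ‖ ^ N) (𝓝 0)).mul_isLittleO h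

theorem isBigO_one_of_continuousAt {F : Type*} [NormedAddCommGroup F] {f : ℂ → F} (hf : ContinuousAt f 0) :
    f =O[𝓝 0] fun ζ : ℂ => ‖ζ‖ ^ 0 := by
  simpa using hf.isBigO_one ℝ

variable {F : Type*} [NormedAddCommGroup F] [NormedSpace ℝ F]

theorem contDiffAt_fderiv {E : Type*} [NormedAddCommGroup E] [NormedSpace ℝ E] {f : E → F} {x : E}
    (hf : ContDiffAt ℝ ∞ f x) : ContDiffAt ℝ ∞ (fderiv ℝ f) x :=
  hf.fderiv_right (by simp)

theorem eventually_contDiffAt_two {E : Type*} [NormedAddCommGroup E] [NormedSpace ℝ E] {f : E → F}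
    {x : E} (hf : ContDiffAt ℝ ∞ f x) : ∀ᶠ y in 𝓝 x, ContDiffAt ℝ 2 f y :=
  (hf.of_le ENat.LEInfty.out).eventually (by simp)

theorem eventually_differentiableAt {E : Type*} [NormedAddCommGroup E] [NormedSpace ℝ E]
    {f : E → F} {x : E} (hf : ContDiffAt ℝ ∞ f x) : ∀ᶠ y in 𝓝 x, DifferentiableAt ℝ f y :=
  (eventually_contDiffAt_two hf).mono fun _ h => h.differentiableAt (by norm_num)

theorem isBigO_of_fderiv {f : ℂ → F} {N : ℕ} (hf : ContDiffAt ℝ ∞ f 0) (h0 : f 0 = 0)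
    (hD : fderiv ℝ f =O[𝓝 0] fun ζ : ℂ => ‖ζ‖ ^ N) : f =O[𝓝 0] fun ζ : ℂ => ‖ζ‖ ^ (N + 1) := by
  obtain ⟨C, hC, hb⟩ := hD.exists_nonneg
  obtain ⟨δ, hδ, hball⟩ := Metric.eventually_nhds_iff_ball.1
    ((isBigOWith_iff.1 hb).and (eventually_differentiableAt hf))
  refine IsBigO.of_bound C ?_
  filter_upwards [Metric.ball_mem_nhds (0 : ℂ) hδ] with ζ hζ
  have hsub : Metric.closedBall (0 : ℂ) ‖ζ‖ ⊆ Metric.ball 0 δ :=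
    Metric.closedBall_subset_ball (by simpa using hζ)
  have := (convex_closedBall (0 : ℂ) ‖ζ‖).norm_image_sub_le_of_norm_fderiv_le (𝕜 := ℝ)
    (f := f) (C := C * ‖ζ‖ ^ N) (fun x hx => (hball x (hsub hx)).2)
    (fun x hx => ?_) (x := 0) (y := ζ) (by simp) (by simp)
  · simpa [h0, pow_succ, mul_assoc] using this
  · refine (hball x (hsub hx)).1.trans ?_
    have : ‖x‖ ≤ ‖ζ‖ := by simpa using hx
    simp only [norm_pow, norm_norm]
    gcongr

theorem fderiv_eq_zero_of_isLittleO {f : ℂ → F} {N : ℕ}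
    (ho : f =o[𝓝 0] fun ζ : ℂ => ‖ζ‖ ^ (N + 1)) : fderiv ℝ f 0 = 0 := by
  have h1 : f =o[𝓝 0] fun ζ : ℂ => ‖ζ‖ ^ 1 :=
    ho.trans_isBigO (isBigO_norm_pow_mono (f := fun ζ : ℂ => ‖ζ‖ ^ (N + 1)) (isBigO_refl _ _)
      (by omega))
  have h0 : f 0 = 0 := by
    have := h1.isBigO.eq_zero_imp.self_of_nhds
    exact this (by simp)
  have : HasFDerivAt f (0 : ℂ →L[ℝ] F) 0 := by
    rw [hasFDerivAt_iff_isLittleO]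
    simp only [pow_one] at h1
    simpa [h0] using h1.of_norm_right
  exact this.fderiv

/-- A Landau-type interpolation: a difference quotient of `f` with step `ε‖ζ‖` approximates the
derivative, with an error controlled by the second derivative. First `ε` is taken small, then the
little-o constant. -/
theorem fderiv_isLittleO {f : ℂ → F} {N : ℕ} (hf : ContDiffAt ℝ ∞ f 0)
    (ho : f =o[𝓝 0] fun ζ : ℂ => ‖ζ‖ ^ (N + 1))
    (h2 : fderiv ℝ (fderiv ℝ f) =O[𝓝 0] fun ζ : ℂ => ‖ζ‖ ^ (N - 1)) :
    fderiv ℝ f =o[𝓝 0] fun ζ : ℂ => ‖ζ‖ ^ N := by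
  rw [isLittleO_iff]
  intro η hη
  obtain ⟨C, hC, hb⟩ := h2.exists_pos
  -- Makes the second-order error at most `η / 2 * ‖ζ‖ ^ N`; the factor `2 ^ (N - 1)` arises because
  -- points within `ε‖ζ‖` of `ζ` have norm at most `2‖ζ‖`.
  set ε : ℝ := min 1 (η / (2 * (C * 2 ^ (N - 1)))) with hε
  have hε0 : 0 < ε := by positivity
  have hε1 : ε ≤ 1 := min_le_left _ _
  have hε2 : C * 2 ^ (N - 1) * ε ≤ η / 2 := by
    have h := min_le_right 1 (η / (2 * (C * 2 ^ (N - 1))))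
    rw [← hε, le_div_iff₀ (by positivity)] at h
    linarith
  -- Makes the two values of `f`, divided by the step `ε‖ζ‖`, contribute exactly `η / 2 * ‖ζ‖ ^ N`.
  set κ : ℝ := η * ε / (2 * (2 ^ (N + 1) + 1)) with hκ
  have hκ0 : 0 < κ := by positivity
  obtain ⟨δ, hδ, hball⟩ := Metric.eventually_nhds_iff_ball.1
    ((((isBigOWith_iff.1 hb).and (eventually_differentiableAt hf)).and
      (eventually_differentiableAt (contDiffAt_fderiv hf))).and (isLittleO_iff.1 ho hκ0))
  filter_upwards [Metric.ball_mem_nhds (0 : ℂ) (half_pos hδ),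
    Metric.ball_mem_nhds (0 : ℂ) one_pos] with ζ hζ hζ1
  rw [mem_ball_zero_iff] at hζ hζ1
  rcases eq_or_ne ζ 0 with rfl | hne
  · rw [fderiv_eq_zero_of_isLittleO ho]
    simp only [norm_zero]
    positivity
  have hn : 0 < ‖ζ‖ := norm_pos_iff.2 hne
  refine ContinuousLinearMap.opNorm_le_of_unit_norm (by positivity) fun u hu => ?_
  set r := ε * ‖ζ‖ with hr
  have hr0 : 0 < r := by positivity
  have hrl : r ≤ ‖ζ‖ := by nlinarith
  have hin : ∀ x ∈ Metric.closedBall ζ r, ‖x‖ ≤ 2 * ‖ζ‖ ∧ x ∈ Metric.ball (0 : ℂ) δ := by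
    intro x hx
    have h1 : ‖x - ζ‖ ≤ r := by simpa [dist_eq_norm] using hx
    have h3 : ‖x‖ ≤ ‖x - ζ‖ + ‖ζ‖ := by simpa using norm_add_le (x - ζ) ζ
    exact ⟨by linarith, by rw [mem_ball_zero_iff]; linarith⟩
  have hv : ζ + r • u ∈ Metric.closedBall ζ r := by
    simp [dist_eq_norm, hu, abs_of_pos hr0]
  have hself : ζ ∈ Metric.closedBall ζ r := by simpa using hr0.le
  have hD : ∀ x ∈ Metric.closedBall ζ r,
      ‖fderiv ℝ f x - fderiv ℝ f ζ‖ ≤ C * (2 * ‖ζ‖) ^ (N - 1) * r := by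
    intro x hx
    have := (convex_closedBall ζ r).norm_image_sub_le_of_norm_fderiv_le (𝕜 := ℝ)
      (f := fderiv ℝ f) (C := C * (2 * ‖ζ‖) ^ (N - 1))
      (fun y hy => (hball y (hin y hy).2).1.2) (fun y hy => ?_) hself hx
    · refine this.trans ?_
      have hx' : ‖x - ζ‖ ≤ r := by simpa [dist_eq_norm] using hx
      gcongr
    · refine (hball y (hin y hy).2).1.1.1.trans ?_
      have := (hin y hy).1
      simp only [norm_pow, norm_norm]
      gcongr
  have hT := (convex_closedBall ζ r).norm_image_sub_le_of_norm_fderiv_le' (𝕜 := ℝ)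
    (f := f) (fun y hy => (hball y (hin y hy).2).1.1.2) hD hself hv
  have e1 : ζ + r • u - ζ = r • u := by abel
  rw [e1, map_smul, norm_smul, hu, Real.norm_of_nonneg hr0.le, mul_one] at hT
  have hA := (hball ζ (hin ζ hself).2).2
  have hB := (hball _ (hin _ hv).2).2
  have hB' : ‖f (ζ + r • u)‖ ≤ κ * (2 * ‖ζ‖) ^ (N + 1) := by
    refine hB.trans ?_
    have := (hin _ hv).1
    simp only [norm_pow, norm_norm]
    gcongr
  simp only [norm_pow, norm_norm] at hA ⊢
  have h4 : r * ‖fderiv ℝ f ζ u‖ ≤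
      κ * (2 * ‖ζ‖) ^ (N + 1) + κ * ‖ζ‖ ^ (N + 1) + C * (2 * ‖ζ‖) ^ (N - 1) * r * r := by
    have h5 : ‖r • fderiv ℝ f ζ u‖ ≤ ‖f (ζ + r • u)‖ + ‖f ζ‖
        + ‖f (ζ + r • u) - f ζ - r • fderiv ℝ f ζ u‖ := by
      have : r • fderiv ℝ f ζ u = (f (ζ + r • u) - f ζ)
        - (f (ζ + r • u) - f ζ - r • fderiv ℝ f ζ u) := by abel
      calc _ = ‖(f (ζ + r • u) - f ζ) - (f (ζ + r • u) - f ζ - r • fderiv ℝ f ζ u)‖ := by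
            rw [← this]
        _ ≤ _ := (norm_sub_le _ _).trans (by gcongr; exact norm_sub_le _ _)
    rw [norm_smul, Real.norm_of_nonneg hr0.le] at h5
    linarith
  have hpow : ‖ζ‖ ^ (N - 1) * ‖ζ‖ ≤ ‖ζ‖ ^ N := by
    rw [← pow_succ]
    exact pow_le_pow_of_le_one hn.le hζ1.le (by omega)
  have h6 : κ * (2 * ‖ζ‖) ^ (N + 1) + κ * ‖ζ‖ ^ (N + 1) = r * (η / 2 * ‖ζ‖ ^ N) := by
    rw [hκ, hr, mul_pow]
    field_simp
    ring
  have h7 : C * (2 * ‖ζ‖) ^ (N - 1) * r * r ≤ r * (η / 2 * ‖ζ‖ ^ N) := by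
    calc C * (2 * ‖ζ‖) ^ (N - 1) * r * r
        = r * ((C * 2 ^ (N - 1) * ε) * (‖ζ‖ ^ (N - 1) * ‖ζ‖)) := by rw [mul_pow, hr]; ring
      _ ≤ _ := by gcongr
  have h8 : r * ‖fderiv ℝ f ζ u‖ ≤ r * (η * ‖ζ‖ ^ N) := by
    calc _ ≤ _ := h4
      _ ≤ r * (η / 2 * ‖ζ‖ ^ N) + r * (η / 2 * ‖ζ‖ ^ N) := by linarith
      _ = _ := by ring
  exact le_of_mul_le_mul_left h8 hr0

theorem iteratedFDeriv_succ_eq_zero_iff {f : ℂ → F} {k : ℕ} :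
    iteratedFDeriv ℝ (k + 1) f 0 = 0 ↔ iteratedFDeriv ℝ k (fderiv ℝ f) 0 = 0 := by
  rw [← norm_eq_zero, ← norm_iteratedFDeriv_fderiv, norm_eq_zero]

theorem iteratedFDeriv_zero_eq_zero_iff {f : ℂ → F} :
    iteratedFDeriv ℝ 0 f 0 = 0 ↔ f 0 = 0 := by
  rw [← norm_eq_zero, norm_iteratedFDeriv_zero, norm_eq_zero]

end Order

theorem isBigO_of_iteratedFDeriv_eq_zero (N : ℕ) :
    ∀ {F : Type*} [NormedAddCommGroup F] [NormedSpace ℝ F] {f : ℂ → F},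
      ContDiffAt ℝ ∞ f 0 → (∀ k < N, iteratedFDeriv ℝ k f 0 = 0) →
        f =O[𝓝 0] fun ζ : ℂ => ‖ζ‖ ^ N := by
  induction N with
  | zero => exact fun hf _ => isBigO_one_of_continuousAt hf.continuousAt
  | succ N ih =>
    intro F _ _ f hf h
    exact isBigO_of_fderiv hf (iteratedFDeriv_zero_eq_zero_iff.1 (h 0 (by omega)))
      (ih (contDiffAt_fderiv hf) fun k hk =>
        iteratedFDeriv_succ_eq_zero_iff.1 (h (k + 1) (by omega)))

theorem iteratedFDeriv_eq_zero_of_isLittleO (N : ℕ) :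
    ∀ {F : Type*} [NormedAddCommGroup F] [NormedSpace ℝ F] {f : ℂ → F},
      ContDiffAt ℝ ∞ f 0 → (f =o[𝓝 0] fun ζ : ℂ => ‖ζ‖ ^ N) →
        ∀ k < N + 1, iteratedFDeriv ℝ k f 0 = 0 := by
  induction N with
  | zero =>
    intro F _ _ f hf ho k hk
    obtain rfl : k = 0 := by omega
    rw [iteratedFDeriv_zero_eq_zero_iff]
    simp only [pow_zero, isLittleO_one_iff] at ho
    exact tendsto_nhds_unique hf.continuousAt ho
  | succ N ih =>
    intro F _ _ f hf ho
    have h1 := ih hf (ho.trans isLittleO_norm_pow_succ)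
    -- The derivatives already known to vanish give the a priori bound that the interpolation needs;
    -- for `N = 0` the truncated exponent only asks for boundedness.
    have h2 : fderiv ℝ (fderiv ℝ f) =O[𝓝 0] fun ζ : ℂ => ‖ζ‖ ^ (N - 1) :=
      isBigO_of_iteratedFDeriv_eq_zero (N - 1) (contDiffAt_fderiv (contDiffAt_fderiv hf))
        fun k hk => iteratedFDeriv_succ_eq_zero_iff.1
          (iteratedFDeriv_succ_eq_zero_iff.1 (h1 (k + 2) (by omega)))
    have h3 := ih (contDiffAt_fderiv hf) (fderiv_isLittleO hf ho h2)
    rintro (_ | k) hk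
    · exact h1 0 (by omega)
    · exact iteratedFDeriv_succ_eq_zero_iff.2 (h3 k (by omega))

/-! ### Integrality of the order -/

section Order

variable {F : Type*} [NormedAddCommGroup F] [NormedSpace ℝ F] {f : ℂ → F} {N : ℕ}

/-- Orders of smooth functions are integers, so any gain beyond `N`, however small, is a gain of a
full unit. -/
theorem isBigO_succ_of_isLittleO (hf : ContDiffAt ℝ ∞ f 0)
    (ho : f =o[𝓝 0] fun ζ : ℂ => ‖ζ‖ ^ N) : f =O[𝓝 0] fun ζ : ℂ => ‖ζ‖ ^ (N + 1) :=
  isBigO_of_iteratedFDeriv_eq_zero _ hf (iteratedFDeriv_eq_zero_of_isLittleO N hf ho)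

theorem isBigO_iff_iteratedFDeriv_eq_zero (hf : ContDiffAt ℝ ∞ f 0) :
    (f =O[𝓝 0] fun ζ : ℂ => ‖ζ‖ ^ N) ↔ ∀ k < N, iteratedFDeriv ℝ k f 0 = 0 := by
  refine ⟨fun h => ?_, isBigO_of_iteratedFDeriv_eq_zero _ hf⟩
  cases N with
  | zero => simp
  | succ N =>
    exact iteratedFDeriv_eq_zero_of_isLittleO N hf (h.trans_isLittleO isLittleO_norm_pow_succ)

theorem le_ord₀_iff (hf : ContDiffAt ℝ ∞ f 0) :
    (N : ℕ∞) ≤ ord₀ f ↔ f =O[𝓝 0] fun ζ : ℂ => ‖ζ‖ ^ N := by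
  rw [isBigO_iff_iteratedFDeriv_eq_zero hf]
  simp only [ord₀, le_iInf_iff, Nat.cast_le]
  exact forall_congr' fun k => ⟨fun h hk => by_contra fun hne => by have := h hne; omega,
    fun h hne => by_contra fun hk => hne (h (by omega))⟩

theorem fderiv_isBigO (hf : ContDiffAt ℝ ∞ f 0) (h : f =O[𝓝 0] fun ζ : ℂ => ‖ζ‖ ^ N) :
    fderiv ℝ f =O[𝓝 0] fun ζ : ℂ => ‖ζ‖ ^ (N - 1) := by
  rw [isBigO_iff_iteratedFDeriv_eq_zero (contDiffAt_fderiv hf)]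
  exact fun k hk => iteratedFDeriv_succ_eq_zero_iff.1
    ((isBigO_iff_iteratedFDeriv_eq_zero hf).1 h (k + 1) (by omega))

/-- If `|f|²` vanishes to order `2N - 1`, then `f` vanishes to order `N`. -/
theorem isBigO_of_sq_isBigO (hf : ContDiffAt ℝ ∞ f 0)
    (h : (fun ζ => ‖f ζ‖ ^ 2) =O[𝓝 0] fun ζ : ℂ => ‖ζ‖ ^ (2 * N - 1)) :
    f =O[𝓝 0] fun ζ : ℂ => ‖ζ‖ ^ N := by
  cases N with
  | zero => exact isBigO_one_of_continuousAt hf.continuousAt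
  | succ N =>
    refine isBigO_succ_of_isLittleO hf (IsLittleO.of_pow (n := 2) ?_ two_ne_zero |>.of_norm_left)
    have h' : (fun ζ => ‖f ζ‖ ^ 2) =O[𝓝 0] fun ζ : ℂ => ‖ζ‖ ^ (2 * N + 1) := by
      simpa [Nat.mul_add] using h
    have := h'.trans_isLittleO isLittleO_norm_pow_succ
    simpa [Pi.pow_def, ← pow_mul, mul_comm] using this

end Order

/-! ### Chain rule for second derivatives -/

section SecondDerivative

variable {V E F : Type*} [NormedAddCommGroup V] [NormedSpace ℝ V]
  [NormedAddCommGroup E] [NormedSpace ℝ E] [NormedAddCommGroup F] [NormedSpace ℝ F]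

theorem differentiableAt_fderiv_of_contDiffAt_two {f : V → F} {z : V} (hf : ContDiffAt ℝ 2 f z) :
    DifferentiableAt ℝ (fderiv ℝ f) z :=
  (hf.fderiv_right (m := 1) (by norm_num)).differentiableAt (by norm_num)

theorem eventually_differentiableAt_of_two {f : V → F} {z : V} (hf : ContDiffAt ℝ 2 f z) :
    ∀ᶠ y in 𝓝 z, DifferentiableAt ℝ f y :=
  (hf.eventually (by simp)).mono fun _ h => h.differentiableAt (by norm_num)

theorem fderiv_fderiv_apply {f : V → F} {z : V} (hf : ContDiffAt ℝ 2 f z) (t u : V) :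
    fderiv ℝ (fun y => fderiv ℝ f y u) z t = fderiv ℝ (fderiv ℝ f) z t u := by
  have := (differentiableAt_fderiv_of_contDiffAt_two hf).hasFDerivAt.clm_apply
    (hasFDerivAt_const u z)
  rw [this.fderiv]
  simp

theorem fderiv_fderiv_comp {k : E → ℝ} {γ : V → E} {z : V} (hk : ContDiffAt ℝ 2 k (γ z))
    (hγ : ContDiffAt ℝ 2 γ z) (t : V) :
    fderiv ℝ (fderiv ℝ (fun y => k (γ y))) z t t =
      fderiv ℝ (fderiv ℝ k) (γ z) (fderiv ℝ γ z t) (fderiv ℝ γ z t)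
        + fderiv ℝ k (γ z) (fderiv ℝ (fderiv ℝ γ) z t t) := by
  have hc : ContDiffAt ℝ 2 (fun y => k (γ y)) z := hk.comp z hγ
  rw [← fderiv_fderiv_apply hc]
  have he : (fun y => fderiv ℝ (fun y => k (γ y)) y t) =ᶠ[𝓝 z]
      fun y => fderiv ℝ k (γ y) (fderiv ℝ γ y t) := by
    filter_upwards [eventually_differentiableAt_of_two hγ,
      hγ.continuousAt.eventually (eventually_differentiableAt_of_two hk)] with y h1 h2
    rw [show (fun y => k (γ y)) = k ∘ γ from rfl, fderiv_comp y h2 h1]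
    rfl
  rw [he.fderiv_eq]
  have h1 : HasFDerivAt (fun y => fderiv ℝ k (γ y))
      ((fderiv ℝ (fderiv ℝ k) (γ z)).comp (fderiv ℝ γ z)) z :=
    (differentiableAt_fderiv_of_contDiffAt_two hk).hasFDerivAt.comp z
      (hγ.differentiableAt (by norm_num)).hasFDerivAt
  have h2 : HasFDerivAt (fun y => fderiv ℝ γ y t) ((fderiv ℝ (fderiv ℝ γ) z).flip t) z := by
    have := (differentiableAt_fderiv_of_contDiffAt_two hγ).hasFDerivAt.clm_apply
      (hasFDerivAt_const t z)
    simpa using this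
  rw [(h1.clm_apply h2).fderiv]
  simp [add_comm]

end SecondDerivative

/-! ### The Levi form and the (1,0)-differential -/

section Levi

variable {V E : Type*} [NormedAddCommGroup V] [NormedSpace ℂ V]
  [NormedAddCommGroup E] [NormedSpace ℂ E]

/-- The `(1, 0)`-differential `∂f(z)` of a real function, so that `∂f(z) t = ∑ (∂f/∂z_j) t_j`. -/
noncomputable def dolb (f : V → ℝ) (z : V) : V →L[ℂ] ℂ :=
  (1 / 2 : ℂ) • StrongDual.extendRCLike (𝕜 := ℂ) (fderiv ℝ f z)

theorem dolb_apply (f : V → ℝ) (z t : V) :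
    dolb f z t = 1 / 2 * (fderiv ℝ f z t - Complex.I * fderiv ℝ f z (Complex.I • t)) := by
  simp [dolb, StrongDual.extendRCLike_apply]

theorem norm_sq_dolb (f : V → ℝ) (z t : V) : ‖dolb f z t‖ ^ 2 =
    (fderiv ℝ f z t ^ 2 + fderiv ℝ f z (Complex.I • t) ^ 2) / 4 := by
  rw [dolb_apply, ← Complex.normSq_eq_norm_sq, Complex.normSq_apply]
  simp
  ring

theorem dolb_eq_zero_iff {f : V → ℝ} {z t : V} : dolb f z t = 0 ↔ IsComplexTangent f z t := by
  rw [← norm_eq_zero, ← sq_eq_zero_iff, norm_sq_dolb, IsComplexTangent]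
  constructor
  · intro h
    constructor <;> nlinarith [sq_nonneg (fderiv ℝ f z t),
      sq_nonneg (fderiv ℝ f z (Complex.I • t))]
  · rintro ⟨h1, h2⟩
    simp [h1, h2]

theorem dolb_zero {f : V → ℝ} {z : V} (h : fderiv ℝ f z = 0) : dolb f z = 0 := by
  ext t
  simp [dolb_apply, h]

theorem dolb_ne_zero {f : V → ℝ} {z : V} (h : fderiv ℝ f z ≠ 0) : ∃ t, dolb f z t ≠ 0 := by
  by_contra! hc
  exact h (ContinuousLinearMap.ext fun t => (dolb_eq_zero_iff.1 (hc t)).1)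

@[simp] theorem levi_zero_right (f : V → ℝ) (z : V) : levi f z 0 = 0 := by
  simp [levi]

theorem levi_smul (f : V → ℝ) (z t : V) (a : ℝ) : levi f z (a • t) = a ^ 2 * levi f z t := by
  have : Complex.I • a • t = a • Complex.I • t := smul_comm _ _ _
  simp only [levi, this, map_smul, smul_eq_mul, smul_apply]
  ring

theorem norm_sq_dolb_smul (f : V → ℝ) (z t : V) (a : ℝ) :
    ‖dolb f z (a • t)‖ ^ 2 = a ^ 2 * ‖dolb f z t‖ ^ 2 := by
  have : a • t = (a : ℂ) • t := (Complex.coe_smul a t).symm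
  rw [this, map_smul, norm_smul, mul_pow]
  simp

theorem levi_add {f g : V → ℝ} {z : V} (hf : ContDiffAt ℝ 2 f z) (hg : ContDiffAt ℝ 2 g z)
    (t : V) : levi (fun y => f y + g y) z t = levi f z t + levi g z t := by
  have he : fderiv ℝ (fun y => f y + g y) =ᶠ[𝓝 z] fun y => fderiv ℝ f y + fderiv ℝ g y := by
    filter_upwards [eventually_differentiableAt_of_two hf, eventually_differentiableAt_of_two hg]
      with y h1 h2 using fderiv_fun_add h1 h2
  rw [levi, levi, levi, he.fderiv_eq,
    fderiv_fun_add (differentiableAt_fderiv_of_contDiffAt_two hf)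
      (differentiableAt_fderiv_of_contDiffAt_two hg)]
  simp only [add_apply]
  ring

theorem dolb_add {f g : V → ℝ} {z : V} (hf : DifferentiableAt ℝ f z)
    (hg : DifferentiableAt ℝ g z) (t : V) :
    dolb (fun y => f y + g y) z t = dolb f z t + dolb g z t := by
  rw [dolb_apply, dolb_apply, dolb_apply, fderiv_fun_add hf hg]
  simp only [add_apply]
  push_cast
  ring

theorem levi_sum {ι : Type*} (s : Finset ι) {f : ι → V → ℝ} {z : V}
    (hf : ∀ i ∈ s, ContDiffAt ℝ 2 (f i) z) (t : V) :
    levi (fun y => ∑ i ∈ s, f i y) z t = ∑ i ∈ s, levi (f i) z t := by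
  classical
  induction s using Finset.induction_on with
  | empty => simp [levi]
  | insert a s ha ih =>
    simp only [Finset.sum_insert ha]
    rw [levi_add (hf a (by simp)) (ContDiffAt.sum fun i hi => hf i (by simp [hi])),
      ih fun i hi => hf i (by simp [hi])]

theorem dolb_sum {ι : Type*} (s : Finset ι) {f : ι → V → ℝ} {z : V}
    (hf : ∀ i ∈ s, DifferentiableAt ℝ (f i) z) (t : V) :
    dolb (fun y => ∑ i ∈ s, f i y) z t = ∑ i ∈ s, dolb (f i) z t := by
  classical
  induction s using Finset.induction_on with
  | empty => simp [dolb_apply]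
  | insert a s ha ih =>
    simp only [Finset.sum_insert ha]
    rw [dolb_add (hf a (by simp)) (DifferentiableAt.fun_sum fun i hi => hf i (by simp [hi])),
      ih fun i hi => hf i (by simp [hi])]

theorem fderiv_apply_of_holomorphic {γ : V → E} {z : V} (hγ : DifferentiableAt ℂ γ z) (t : V) :
    fderiv ℝ γ z t = fderiv ℂ γ z t := by
  rw [hγ.fderiv_restrictScalars ℝ]
  rfl

theorem fderiv_fderiv_apply_of_holomorphic {γ : V → E} {z : V} (hγ : ContDiffAt ℂ 2 γ z) (t : V) :
    fderiv ℝ (fderiv ℝ γ) z t t = fderiv ℂ (fderiv ℂ γ) z t t := by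
  rw [← fderiv_fderiv_apply (hγ.restrict_scalars ℝ)]
  have he : (fun y => fderiv ℝ γ y t) =ᶠ[𝓝 z] fun y => fderiv ℂ γ y t := by
    filter_upwards [hγ.eventually (by simp)] with y hy using
      fderiv_apply_of_holomorphic (hy.differentiableAt (by norm_num)) t
  have hd : DifferentiableAt ℂ (fderiv ℂ γ) z :=
    (hγ.fderiv_right (m := 1) (by norm_num)).differentiableAt (by norm_num)
  have h2 : HasFDerivAt (fun y => fderiv ℂ γ y t) ((fderiv ℂ (fderiv ℂ γ) z).flip t) z := by
    have := hd.hasFDerivAt.clm_apply (hasFDerivAt_const t z)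
    simpa using this
  rw [he.fderiv_eq, fderiv_apply_of_holomorphic h2.differentiableAt, h2.fderiv]
  rfl

theorem dolb_comp {k : E → ℝ} {γ : V → E} {z : V} (hk : DifferentiableAt ℝ k (γ z))
    (hγ : DifferentiableAt ℂ γ z) (t : V) :
    dolb (fun y => k (γ y)) z t = dolb k (γ z) (fderiv ℂ γ z t) := by
  have h : fderiv ℝ (fun y => k (γ y)) z = (fderiv ℝ k (γ z)).comp (fderiv ℝ γ z) :=
    fderiv_comp z hk (hγ.restrictScalars ℝ)
  rw [dolb_apply, dolb_apply, h]
  simp [fderiv_apply_of_holomorphic hγ]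

theorem levi_comp {k : E → ℝ} {γ : V → E} {z : V} (hk : ContDiffAt ℝ 2 k (γ z))
    (hγ : ContDiffAt ℂ 2 γ z) (t : V) :
    levi (fun y => k (γ y)) z t = levi k (γ z) (fderiv ℂ γ z t) := by
  have hd := hγ.differentiableAt (by norm_num)
  rw [levi, fderiv_fderiv_comp hk (hγ.restrict_scalars ℝ),
    fderiv_fderiv_comp hk (hγ.restrict_scalars ℝ), fderiv_fderiv_apply_of_holomorphic hγ,
    fderiv_fderiv_apply_of_holomorphic hγ, fderiv_apply_of_holomorphic hd,
    fderiv_apply_of_holomorphic hd, levi]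
  -- Complex bilinearity makes the terms with the second derivative of `γ` cancel in the Levi form.
  have : fderiv ℂ (fderiv ℂ γ) z (Complex.I • t) (Complex.I • t)
      = -fderiv ℂ (fderiv ℂ γ) z t t := by
    simp only [map_smul, smul_apply, smul_smul, Complex.I_mul_I, neg_one_smul]
  rw [this, map_neg, map_smul]
  ring

theorem dolb_comp_clm {k : E → ℝ} (A : V →L[ℂ] E) {z : V} (hk : DifferentiableAt ℝ k (A z))
    (t : V) : dolb (fun y => k (A y)) z t = dolb k (A z) (A t) := by
  rw [dolb_comp hk A.differentiableAt, A.fderiv]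

theorem levi_comp_clm {k : E → ℝ} (A : V →L[ℂ] E) {z : V} (hk : ContDiffAt ℝ 2 k (A z))
    (t : V) : levi (fun y => k (A y)) z t = levi k (A z) (A t) := by
  rw [levi_comp hk A.contDiff.contDiffAt, A.fderiv]

/-- Source of all the curvature inequalities: with both forms normalised by a quarter, `χ''`
multiplies exactly `|∂f|²`. -/
theorem levi_real_comp {χ : ℝ → ℝ} {f : V → ℝ} {z : V} (hχ : ContDiffAt ℝ 2 χ (f z))
    (hf : ContDiffAt ℝ 2 f z) (t : V) :
    levi (fun y => χ (f y)) z t =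
      deriv χ (f z) * levi f z t + deriv (deriv χ) (f z) * ‖dolb f z t‖ ^ 2 := by
  have h2 : ∀ a : ℝ, fderiv ℝ (fderiv ℝ χ) (f z) a a = deriv (deriv χ) (f z) * a ^ 2 := by
    intro a
    rw [← fderiv_fderiv_apply hχ]
    have : (fun y => fderiv ℝ χ y a) = fun y => a * deriv χ y := by
      ext y
      rw [fderiv_eq_smul_deriv, smul_eq_mul]
    have hd : DifferentiableAt ℝ (deriv χ) (f z) := by
      have := (differentiableAt_fderiv_of_contDiffAt_two hχ).clm_apply
        (differentiableAt_const (1 : ℝ))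
      simpa using this
    rw [this, fderiv_eq_smul_deriv, deriv_const_mul _ hd]
    simp only [smul_eq_mul]
    ring
  rw [levi, fderiv_fderiv_comp hχ hf, fderiv_fderiv_comp hχ hf, h2, h2, norm_sq_dolb, levi,
    fderiv_eq_smul_deriv, fderiv_eq_smul_deriv]
  simp only [smul_eq_mul]
  ring

end Levi

/-! ### Curvature inequalities and positivity of the Levi form -/

section Inequalities

variable {V : Type*} [NormedAddCommGroup V] [NormedSpace ℂ V]

theorem levi_neg (f : V → ℝ) (z t : V) : levi (fun y => -f y) z t = -levi f z t := by
  have : fderiv ℝ (fun y => -f y) = fun y => -fderiv ℝ f y := by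
    ext1 y
    exact fderiv_fun_neg
  rw [levi, levi, this, fderiv_fun_neg]
  simp only [neg_apply]
  ring

theorem norm_sq_dolb_neg (f : V → ℝ) (z t : V) :
    ‖dolb (fun y => -f y) z t‖ ^ 2 = ‖dolb f z t‖ ^ 2 := by
  rw [norm_sq_dolb, norm_sq_dolb, fderiv_fun_neg]
  simp

theorem levi_rpow {f : V → ℝ} {z : V} (hf : ContDiffAt ℝ 2 f z) (hpos : 0 < f z) (σ : ℝ) (t : V) :
    levi (fun y => f y ^ σ) z t =
      σ * f z ^ (σ - 2) * (f z * levi f z t - (1 - σ) * ‖dolb f z t‖ ^ 2) := by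
  have h1 : deriv (fun x : ℝ => x ^ σ) =ᶠ[𝓝 (f z)] fun x => σ * x ^ (σ - 1) := by
    filter_upwards [eventually_gt_nhds hpos] with x hx
    exact Real.deriv_rpow_const _ _
  have h2 : deriv (fun x : ℝ => σ * x ^ (σ - 1)) (f z) = σ * ((σ - 1) * f z ^ (σ - 2)) := by
    rw [deriv_const_mul _ (Real.differentiableAt_rpow_const_of_ne _ hpos.ne'),
      Real.deriv_rpow_const, show σ - 1 - 1 = σ - 2 by ring]
  rw [levi_real_comp (χ := fun x : ℝ => x ^ σ) (Real.contDiffAt_rpow_const (Or.inl hpos.ne')) hf,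
    h1.deriv_eq, h2, h1.self_of_nhds]
  have h3 : f z ^ (σ - 1) = f z ^ (σ - 2) * f z := by
    rw [← Real.rpow_add_one hpos.ne']
    ring_nf
  simp only [h3]
  ring

theorem levi_log {f : V → ℝ} {z : V} (hf : ContDiffAt ℝ 2 f z) (hpos : 0 < f z) (t : V) :
    levi (fun y => Real.log (f y)) z t =
      (f z ^ 2)⁻¹ * (f z * levi f z t - ‖dolb f z t‖ ^ 2) := by
  rw [levi_real_comp (χ := Real.log) (Real.contDiffAt_log.2 hpos.ne') hf, Real.deriv_log',
    deriv_inv]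
  field_simp
  ring

/-- The curvature inequality `-ρ · i∂∂̄ρ > -(1 - s) i∂ρ ∧ ∂̄ρ` expressing that `-(-ρ)^s` is strictly
plurisubharmonic. -/
theorem IsDiederichFornaess.levi_gt {Ω : Set V} {ρ : V → ℝ} {s : ℝ}
    (hs : IsDiederichFornaess Ω ρ s) {z t : V} (hz : z ∈ Ω) (hρ : ContDiffAt ℝ 2 ρ z)
    (hneg : ρ z < 0) (ht : t ≠ 0) :
    -(1 - s) * ‖dolb ρ z t‖ ^ 2 < -ρ z * levi ρ z t := by
  have h := hs.strictPSH.2 z hz t ht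
  rw [levi_neg (fun y => (-ρ y) ^ s), levi_rpow (f := fun y => -ρ y) hρ.neg (by linarith),
    levi_neg, norm_sq_dolb_neg, ← mul_neg] at h
  have hp : 0 < s * (-ρ z) ^ (s - 2) := mul_pos hs.pos (Real.rpow_pos_of_pos (by linarith) _)
  have := pos_of_mul_pos_right h hp.le
  linarith

theorem IsAdmissible.pos {h : V → ℝ} (hh : IsAdmissible h) {w : V} (hw : w ≠ 0) : 0 < h w :=
  (hh.nonneg w).lt_of_ne fun h0 => hw ((hh.eq_zero_iff w).1 h0.symm)

theorem IsAdmissible.apply_zero {h : V → ℝ} (hh : IsAdmissible h) : h 0 = 0 :=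
  (hh.eq_zero_iff 0).2 rfl

theorem fderiv_eq_zero_of_nonneg {h : V → ℝ} (hn : ∀ w, 0 ≤ h w) {w : V} (hw : h w = 0) :
    fderiv ℝ h w = 0 :=
  IsLocalMin.fderiv_eq_zero (Filter.Eventually.of_forall fun v => by rw [hw]; exact hn v)

/-- Away from the origin a positive factor is divided out of the Levi form of `h^σ` or `log h`,
which unifies the two cases. At the origin both sides vanish, `h` having a minimum with value 0
there. -/
theorem PowerIsPSH.norm_sq_dolb_le {h : V → ℝ} (hh : IsAdmissible h) {σ : ℝ} (hσ : 0 ≤ σ)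
    (hp : PowerIsPSH h σ) (w u : V) : (1 - σ) * ‖dolb h w u‖ ^ 2 ≤ h w * levi h w u := by
  have hc : ContDiffAt ℝ 2 h w := (hh.smooth.of_le ENat.LEInfty.out).contDiffAt
  rcases eq_or_ne w 0 with rfl | hw
  · simp [dolb_zero (fderiv_eq_zero_of_nonneg hh.nonneg hh.apply_zero), hh.apply_zero]
  have hpos := hh.pos hw
  unfold PowerIsPSH at hp
  split_ifs at hp with h0
  · have := hp.2 w (by simpa using hw) u
    rw [levi_log hc hpos] at this
    have := nonneg_of_mul_nonneg_right this (by positivity)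
    rw [h0]
    linarith
  · have := hp.2 w (by simpa using hw) u
    rw [levi_rpow hc hpos] at this
    have hq : 0 < σ * h w ^ (σ - 2) :=
      mul_pos (hσ.lt_of_ne (Ne.symm h0)) (Real.rpow_pos_of_pos hpos _)
    have := nonneg_of_mul_nonneg_right this hq
    linarith

/-- Cauchy-Schwarz; it shows that the inequality expressing plurisubharmonicity of the logarithm
survives sums, which is why condition II asks for `log h_i`. -/
theorem norm_sq_sum_le {ι : Type*} (s : Finset ι) {d : ι → ℂ} {a l : ι → ℝ} (ha : ∀ i, 0 ≤ a i)
    (hl : ∀ i, 0 ≤ l i) (h : ∀ i, ‖d i‖ ^ 2 ≤ a i * l i) :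
    ‖∑ i ∈ s, d i‖ ^ 2 ≤ (∑ i ∈ s, a i) * ∑ i ∈ s, l i := by
  refine (pow_le_pow_left₀ (norm_nonneg _) (norm_sum_le s d) 2).trans ?_
  exact Finset.sum_sq_le_sum_mul_sum_of_sq_le_mul s (fun i _ => ha i) (fun i _ => hl i)
    fun i _ => h i

/-- Positivity of the Levi form of `ρ(z) + h(w)` on its complex tangent space. -/
theorem levi_add_levi_pos {E F : Type*} [NormedAddCommGroup E] [NormedSpace ℂ E]
    [NormedAddCommGroup F] [NormedSpace ℂ F] {ρ : E → ℝ} {h : F → ℝ} {s σ : ℝ} (hσ : σ < s)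
    {z t : E} {w u : F} (hρ : ∀ t ≠ 0, -(1 - s) * ‖dolb ρ z t‖ ^ 2 < -ρ z * levi ρ z t)
    (hpos : 0 < h w) (hh : (1 - σ) * ‖dolb h w u‖ ^ 2 ≤ h w * levi h w u)
    (hstrict : u ≠ 0 → 0 < levi h w u) (h0 : ρ z + h w = 0)
    (htan : dolb ρ z t + dolb h w u = 0) (hne : t ≠ 0 ∨ u ≠ 0) :
    0 < levi ρ z t + levi h w u := by
  by_cases ht : t = 0
  · subst ht
    simpa using hstrict (by simpa using hne)
  · have h1 := hρ t ht
    have h2 : ‖dolb ρ z t‖ ^ 2 = ‖dolb h w u‖ ^ 2 := by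
      rw [eq_neg_of_add_eq_zero_left htan, norm_neg]
    rw [show -ρ z = h w by linarith, h2] at h1
    have h3 : 0 ≤ (s - σ) * ‖dolb h w u‖ ^ 2 := mul_nonneg (by linarith) (by positivity)
    have : 0 < h w * (levi ρ z t + levi h w u) := by nlinarith
    exact pos_of_mul_pos_right this hpos.le

/-- The semidefinite version, needed where some components of `w` vanish and `h` is merely
plurisubharmonic. -/
theorem levi_add_levi_nonneg {E F : Type*} [NormedAddCommGroup E] [NormedSpace ℂ E]
    [NormedAddCommGroup F] [NormedSpace ℂ F] {ρ : E → ℝ} {h : F → ℝ} {s σ : ℝ} (hσ : σ < s)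
    {z t : E} {w u : F} (hρ : ∀ t ≠ 0, -(1 - s) * ‖dolb ρ z t‖ ^ 2 < -ρ z * levi ρ z t)
    (hpos : 0 < h w) (hh : (1 - σ) * ‖dolb h w u‖ ^ 2 ≤ h w * levi h w u)
    (hnonneg : 0 ≤ levi h w u) (h0 : ρ z + h w = 0)
    (htan : dolb ρ z t + dolb h w u = 0) :
    0 ≤ levi ρ z t + levi h w u := by
  by_cases ht : t = 0
  · subst ht
    simpa using hnonneg
  · have h1 := hρ t ht
    have h2 : ‖dolb ρ z t‖ ^ 2 = ‖dolb h w u‖ ^ 2 := by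
      rw [eq_neg_of_add_eq_zero_left htan, norm_neg]
    rw [show -ρ z = h w by linarith, h2] at h1
    have h3 : 0 ≤ (s - σ) * ‖dolb h w u‖ ^ 2 := mul_nonneg (by linarith) (by positivity)
    have : 0 < h w * (levi ρ z t + levi h w u) := by nlinarith
    exact (pos_of_mul_pos_right this hpos.le).le

end Inequalities

/-! ### Absence of cancellation along holomorphic discs -/

section Discs

variable {f g b : ℂ → ℝ} {N M : ℕ}

theorem norm_sq_dolb_one_le (f : ℂ → ℝ) (ζ : ℂ) : ‖dolb f ζ 1‖ ^ 2 ≤ ‖fderiv ℝ f ζ‖ ^ 2 := by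
  have h1 := (fderiv ℝ f ζ).le_opNorm 1
  have h2 := (fderiv ℝ f ζ).le_opNorm Complex.I
  simp only [norm_one, Complex.norm_I, mul_one] at h1 h2
  rw [Real.norm_eq_abs] at h1 h2
  have h1' := sq_le_sq' (abs_le.1 h1).1 (abs_le.1 h1).2
  have h2' := sq_le_sq' (abs_le.1 h2).1 (abs_le.1 h2).2
  rw [norm_sq_dolb, smul_eq_mul, mul_one]
  nlinarith [sq_nonneg ‖fderiv ℝ f ζ‖]

/-- In one complex variable `∂f` on the vector `1` controls the whole real derivative. The 8 is the
2 of `(a + b)² ≤ 2(a² + b²)` times the normalising 4. -/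
theorem norm_sq_fderiv_le (f : ℂ → ℝ) (ζ : ℂ) : ‖fderiv ℝ f ζ‖ ^ 2 ≤ 8 * ‖dolb f ζ 1‖ ^ 2 := by
  have hb : ‖fderiv ℝ f ζ‖ ≤ |fderiv ℝ f ζ 1| + |fderiv ℝ f ζ Complex.I| := by
    refine ContinuousLinearMap.opNorm_le_bound _ (by positivity) fun v => ?_
    have hv : fderiv ℝ f ζ v = v.re * fderiv ℝ f ζ 1 + v.im * fderiv ℝ f ζ Complex.I := by
      conv_lhs => rw [show v = v.re • (1 : ℂ) + v.im • Complex.I by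
        simp]
      rw [map_add, map_smul, map_smul, smul_eq_mul, smul_eq_mul]
    rw [hv, Real.norm_eq_abs]
    refine (abs_add_le _ _).trans ?_
    rw [abs_mul, abs_mul, add_mul, mul_comm |v.re|, mul_comm |v.im|]
    gcongr
    exacts [Complex.abs_re_le_norm v, Complex.abs_im_le_norm v]
  have h2 := pow_le_pow_left₀ (norm_nonneg _) hb 2
  rw [norm_sq_dolb, smul_eq_mul, mul_one]
  nlinarith [sq_nonneg (|fderiv ℝ f ζ 1| - |fderiv ℝ f ζ Complex.I|),
    sq_abs (fderiv ℝ f ζ 1), sq_abs (fderiv ℝ f ζ Complex.I)]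

theorem dolb_isBigO (hf : ContDiffAt ℝ ∞ f 0) (h : f =O[𝓝 0] fun ζ : ℂ => ‖ζ‖ ^ N) :
    (fun ζ => dolb f ζ 1) =O[𝓝 0] fun ζ : ℂ => ‖ζ‖ ^ (N - 1) := by
  refine IsBigO.trans (IsBigO.of_bound 1 (Eventually.of_forall fun ζ => ?_)) (fderiv_isBigO hf h)
  rw [one_mul]
  exact (sq_le_sq₀ (norm_nonneg _) (norm_nonneg _)).1 (norm_sq_dolb_one_le f ζ)

theorem levi_isBigO (hf : ContDiffAt ℝ ∞ f 0) (h : f =O[𝓝 0] fun ζ : ℂ => ‖ζ‖ ^ N) :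
    (fun ζ => levi f ζ 1) =O[𝓝 0] fun ζ : ℂ => ‖ζ‖ ^ (N - 2) := by
  refine IsBigO.trans (IsBigO.of_bound 1 (Eventually.of_forall fun ζ => ?_))
    (fderiv_isBigO (contDiffAt_fderiv hf) (fderiv_isBigO hf h))
  have h1 := (fderiv ℝ (fderiv ℝ f) ζ).le_opNorm₂ 1 1
  have h2 := (fderiv ℝ (fderiv ℝ f) ζ).le_opNorm₂ Complex.I Complex.I
  simp only [norm_one, Complex.norm_I, mul_one, Real.norm_eq_abs] at h1 h2
  rw [levi, smul_eq_mul, mul_one, one_mul, Real.norm_eq_abs, abs_div, abs_of_pos (four_pos (α := ℝ))]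
  have := abs_add_le (fderiv ℝ (fderiv ℝ f) ζ 1 1)
    (fderiv ℝ (fderiv ℝ f) ζ Complex.I Complex.I)
  have h3 := norm_nonneg (fderiv ℝ (fderiv ℝ f) ζ)
  linarith

theorem isBigO_succ_of_dolb (hb : ContDiffAt ℝ ∞ b 0) (h0 : b 0 = 0)
    (h : (fun ζ => ‖dolb b ζ 1‖ ^ 2) =O[𝓝 0] fun ζ : ℂ => ‖ζ‖ ^ (2 * N - 1)) :
    b =O[𝓝 0] fun ζ : ℂ => ‖ζ‖ ^ (N + 1) := by
  refine isBigO_of_fderiv hb h0 (isBigO_of_sq_isBigO (contDiffAt_fderiv hb) ?_)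
  refine IsBigO.trans (IsBigO.of_bound 8 (Eventually.of_forall fun ζ => ?_)) h
  simpa using norm_sq_fderiv_le b ζ

theorem isBigO_one_of_apply_zero (hb : ContDiffAt ℝ ∞ b 0) (h0 : b 0 = 0) :
    b =O[𝓝 0] fun ζ : ℂ => ‖ζ‖ ^ (0 + 1) :=
  isBigO_of_fderiv hb h0 (isBigO_one_of_continuousAt (contDiffAt_fderiv hb).continuousAt)

theorem norm_pow_isBigO {F : Type*} [NormedAddCommGroup F] {u : ℂ → F} (k : ℕ)
    (h : u =O[𝓝 0] fun ζ : ℂ => ‖ζ‖ ^ N) :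
    (fun ζ => ‖u ζ‖ ^ k) =O[𝓝 0] fun ζ : ℂ => ‖ζ‖ ^ (k * N) := by
  have := h.norm_left.pow k
  simpa [← pow_mul, mul_comm N k] using this

theorem mul_isBigO {u v : ℂ → ℝ} (hu : u =O[𝓝 0] fun ζ : ℂ => ‖ζ‖ ^ M)
    (hv : v =O[𝓝 0] fun ζ : ℂ => ‖ζ‖ ^ N) :
    (fun ζ => u ζ * v ζ) =O[𝓝 0] fun ζ : ℂ => ‖ζ‖ ^ (M + N) := by
  simpa [pow_add] using hu.mul hv

/-- If `f` is strictly pseudo-convex along a disc and `log b` is plurisubharmonic, there is no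
cancellation in `f + b`. -/
theorem isBigO_of_add_isBigO_of_strict {E : Type*} [NormedAddCommGroup E] [NormedSpace ℂ E]
    {γ : ℂ → E} {A c : ℝ} (hf : ContDiffAt ℝ ∞ f 0) (hb : ContDiffAt ℝ ∞ b 0)
    (hγ : ContDiffAt ℂ ∞ γ 0) (hb0 : b 0 = 0) (hγ0 : γ 0 = 0) (hA : 0 ≤ A) (hc : 0 < c)
    (hnonneg : ∀ᶠ ζ in 𝓝 0, 0 ≤ b ζ)
    (hlog : ∀ᶠ ζ in 𝓝 0, ‖dolb b ζ 1‖ ^ 2 ≤ b ζ * levi b ζ 1)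
    (hstrict : ∀ᶠ ζ in 𝓝 0, c * ‖fderiv ℂ γ ζ 1‖ ^ 2 ≤ levi f ζ 1 + A * ‖dolb f ζ 1‖ ^ 2)
    (hg : (fun ζ => f ζ + b ζ) =O[𝓝 0] fun ζ : ℂ => ‖ζ‖ ^ M) :
    (b =O[𝓝 0] fun ζ : ℂ => ‖ζ‖ ^ M) ∧
      ∀ N, 2 * N ≤ M + 1 → γ =O[𝓝 0] fun ζ : ℂ => ‖ζ‖ ^ N := by
  have hgs : ContDiffAt ℝ ∞ (fun ζ => f ζ + b ζ) 0 := hf.add hb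
  have hLg := levi_isBigO hgs hg
  have hdg := norm_pow_isBigO 2 (dolb_isBigO hgs hg)
  have hadd : ∀ᶠ ζ in 𝓝 0, levi (fun ζ => f ζ + b ζ) ζ 1 = levi f ζ 1 + levi b ζ 1 ∧
      dolb (fun ζ => f ζ + b ζ) ζ 1 = dolb f ζ 1 + dolb b ζ 1 := by
    filter_upwards [eventually_contDiffAt_two hf, eventually_contDiffAt_two hb] with ζ h1 h2
    exact ⟨levi_add h1 h2 1, dolb_add (h1.differentiableAt (by norm_num))
      (h2.differentiableAt (by norm_num)) 1⟩
  have hdf : ∀ᶠ ζ in 𝓝 0, ‖dolb f ζ 1‖ ^ 2 ≤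
      2 * ‖dolb (fun ζ => f ζ + b ζ) ζ 1‖ ^ 2 + 2 * ‖dolb b ζ 1‖ ^ 2 := by
    filter_upwards [hadd] with ζ h
    have h1 : ‖dolb f ζ 1‖ ≤ ‖dolb (fun ζ => f ζ + b ζ) ζ 1‖ + ‖dolb b ζ 1‖ := by
      rw [h.2]
      simpa using norm_sub_le (dolb f ζ 1 + dolb b ζ 1) (dolb b ζ 1)
    nlinarith [norm_nonneg (dolb f ζ 1),
      sq_nonneg (‖dolb (fun ζ => f ζ + b ζ) ζ 1‖ - ‖dolb b ζ 1‖)]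
  have hbM : ∀ N ≤ M, b =O[𝓝 0] fun ζ : ℂ => ‖ζ‖ ^ N := by
    intro N
    induction N with
    | zero => exact fun _ => isBigO_one_of_continuousAt hb.continuousAt
    | succ N ih =>
      intro hN
      rcases Nat.eq_zero_or_pos N with rfl | hpos
      · exact isBigO_one_of_apply_zero hb hb0
      have hbN := ih (by omega)
      refine isBigO_succ_of_dolb hb hb0 ?_
      -- With `g = f + b`, the hypotheses give `|∂b|² ≤ b·(Lg + 2A|∂g|² + 2A|∂b|²)`. Since `b` tends
      -- to 0, the last term is absorbed on the left.
      have hsmall : ∀ᶠ ζ in 𝓝 0, 4 * A * b ζ ≤ 1 := by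
        have : Tendsto (fun ζ => 4 * A * b ζ) (𝓝 0) (𝓝 0) := by
          simpa [hb0] using hb.continuousAt.tendsto.const_mul (4 * A)
        exact (this.eventually_lt_const one_pos).mono fun _ h => h.le
      have h1 : (fun ζ => b ζ * (2 * levi (fun ζ => f ζ + b ζ) ζ 1
          + 4 * A * ‖dolb (fun ζ => f ζ + b ζ) ζ 1‖ ^ 2)) =O[𝓝 0]
            fun ζ : ℂ => ‖ζ‖ ^ (2 * N - 1) := by
        -- As `N + 1 ≤ M`, the order `N + (M - 2)` is at least `2N - 1`, which suffices by
        -- integrality.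
        refine isBigO_norm_pow_mono (M := N + (M - 2)) (mul_isBigO hbN ?_) (by omega)
        exact (hLg.const_mul_left 2).add
          ((isBigO_norm_pow_mono hdg (by omega)).const_mul_left (4 * A))
      refine IsBigO.trans (IsBigO.of_bound 1 ?_) h1
      filter_upwards [hadd, hdf, hnonneg, hlog, hstrict, hsmall] with ζ h2 h3 h4 h5 h6 h7
      rw [one_mul, Real.norm_of_nonneg (by positivity)]
      refine le_trans ?_ (le_abs_self _)
      rw [h2.1]
      have h8 : 0 ≤ levi f ζ 1 + A * ‖dolb f ζ 1‖ ^ 2 := le_trans (by positivity) h6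
      have h9 := mul_nonneg h4 h8
      have h10 := mul_le_mul_of_nonneg_left h3 (mul_nonneg hA h4)
      have h11 := mul_le_mul_of_nonneg_right h7 (sq_nonneg ‖dolb b ζ 1‖)
      nlinarith
  have hb' := hbM M le_rfl
  refine ⟨hb', fun N hN => ?_⟩
  cases N with
  | zero => exact isBigO_one_of_continuousAt hγ.continuousAt
  | succ N =>
    have hγr : ContDiffAt ℝ ∞ γ 0 := hγ.restrict_scalars ℝ
    refine isBigO_of_fderiv hγr hγ0 (isBigO_of_sq_isBigO (contDiffAt_fderiv hγr) ?_)
    have hLb := levi_isBigO hb hb'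
    have hdb := norm_pow_isBigO 2 (dolb_isBigO hb hb')
    -- With `b` under control, `Lf + A|∂f|²` has order at least `M - 2`, and by strictness so has
    -- `|γ'|²`.
    have h1 : (fun ζ => c⁻¹ * (levi (fun ζ => f ζ + b ζ) ζ 1 - levi b ζ 1
        + A * (2 * ‖dolb (fun ζ => f ζ + b ζ) ζ 1‖ ^ 2 + 2 * ‖dolb b ζ 1‖ ^ 2))) =O[𝓝 0]
          fun ζ : ℂ => ‖ζ‖ ^ (2 * N - 1) := by
      refine isBigO_norm_pow_mono (M := M - 2) (IsBigO.const_mul_left ?_ _) (by omega)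
      refine (hLg.sub hLb).add (IsBigO.const_mul_left (IsBigO.add ?_ ?_) _)
      · exact (isBigO_norm_pow_mono hdg (by omega)).const_mul_left 2
      · exact (isBigO_norm_pow_mono hdb (by omega)).const_mul_left 2
    refine IsBigO.trans (IsBigO.of_bound 1 ?_) h1
    filter_upwards [hadd, hdf, hstrict,
      (hγ.of_le (m := 2) ENat.LEInfty.out).eventually (by simp)] with ζ h2 h3 h4 h5
    rw [one_mul, Real.norm_of_nonneg (by positivity)]
    refine le_trans ?_ (le_abs_self _)
    have h6 : ‖fderiv ℝ γ ζ‖ ≤ ‖fderiv ℂ γ ζ 1‖ := by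
      refine ContinuousLinearMap.opNorm_le_bound _ (norm_nonneg _) fun v => ?_
      rw [fderiv_apply_of_holomorphic (h5.differentiableAt (by norm_num))]
      have : fderiv ℂ γ ζ v = v • fderiv ℂ γ ζ 1 := by rw [← map_smul, smul_eq_mul, mul_one]
      rw [this, norm_smul, mul_comm]
    rw [le_inv_mul_iff₀ hc, h2.1]
    have h7 := pow_le_pow_left₀ (norm_nonneg _) h6 2
    have h8 := mul_le_mul_of_nonneg_left h3 hA
    have h9 := mul_le_mul_of_nonneg_left h7 hc.le
    linarith

/-- The pointwise estimate of the bootstrap from order `n + 1` to `n + 2`: `B`, `F`, `G` stand for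
`|∂b|`, `|∂f|`, `|∂(f + b)|`, and `lf`, `lb` for Levi forms. The inequality for `f` is available
only where `f < 0`, hence the case distinction on the size of `b`. -/
theorem sq_mul_sq_le_of_power {s σ K r b f B F G lf lb : ℝ} {n : ℕ} (hσ0 : 0 ≤ σ) (hσ : σ < s)
    (hs : s ≤ 1) (hr0 : 0 ≤ r) (hr1 : r ≤ 1) (hK0 : 0 ≤ K) (hb : 0 ≤ b) (hB0 : 0 ≤ B)
    (h1 : b ≤ K * r ^ (n + 1)) (h2 : |f + b| ≤ K * r ^ (n + 1 + 1)) (h3 : B ≤ K * r ^ n)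
    (h4 : G ≤ K * r ^ (n + 1)) (h5 : |lf + lb| ≤ K * r ^ n) (hF : F ≤ G + B) (hF0 : 0 ≤ F)
    (hp : (1 - σ) * B ^ 2 ≤ b * lb) (hn : f < 0 → -(1 - s) * F ^ 2 ≤ -f * lf) :
    b ^ 2 * B ^ 2 ≤ (4 * K ^ 4 + (s - σ)⁻¹ * (6 * K ^ 4)) * r ^ (4 * n + 3) := by
  have hpos : 0 < s - σ := by linarith
  -- Either `b` is already of order `n + 2`, or it dominates `f + b`, so that `f < 0` and `-f` is
  -- comparable with `b`.
  rcases le_or_gt b (2 * (K * r ^ (n + 1 + 1))) with hcase | hcase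
  · calc b ^ 2 * B ^ 2
        ≤ (2 * (K * r ^ (n + 1 + 1))) ^ 2 * (K * r ^ n) ^ 2 := by gcongr
      _ = 4 * K ^ 4 * r ^ (4 * n + 3) * r := by ring
      _ ≤ 4 * K ^ 4 * r ^ (4 * n + 3) * 1 := by gcongr
      _ ≤ _ := by
        rw [add_mul, mul_one]
        have : 0 ≤ (s - σ)⁻¹ * (6 * K ^ 4) * r ^ (4 * n + 3) := by positivity
        linarith
  · have hg1 := (abs_le.1 h2).1
    have hg2 := (abs_le.1 h2).2
    have hk : 0 ≤ K * r ^ (n + 1 + 1) := by positivity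
    have hfneg : f < 0 := by linarith
    have hn' := hn hfneg
    have hf0 : 0 ≤ -f := by linarith
    have hf2 : -f ≤ 2 * (K * r ^ (n + 1)) := by linarith
    set X := K * r ^ n with hX
    set Y := K * r ^ (n + 1) with hY
    set Z := K * r ^ (n + 1 + 1) with hZ
    have hX0 : 0 ≤ X := by positivity
    have hY0 : 0 ≤ Y := by positivity
    have hF2 : F ^ 2 ≤ B ^ 2 + (2 * (X * Y) + Y ^ 2) := by
      have i1 : F ≤ B + Y := by linarith
      have i2 : B * Y ≤ X * Y := mul_le_mul_of_nonneg_right h3 hY0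
      have := pow_le_pow_left₀ hF0 i1 2
      linarith [add_sq B Y]
    -- The inequality for `f` times `b` plus the one for `b` times `-f`; replacing `-f` by `b - (f +
    -- b)` and `|∂f|` by `|∂b|` leaves the gap `s - σ` as coefficient. Each term on the right has
    -- order at least `3n + 2`.
    have e1 : (s - σ) * (b * B ^ 2) ≤ b * (-f) * (lf + lb)
        + (1 - σ) * ((f + b) * B ^ 2) + (1 - s) * (b * (2 * (X * Y) + Y ^ 2)) := by
      have i1 := mul_le_mul_of_nonneg_left hn' hb
      have i2 := mul_le_mul_of_nonneg_left hp hf0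
      have i3 := mul_le_mul_of_nonneg_left hF2 (mul_nonneg (sub_nonneg.2 hs) hb)
      linarith
    have e2 : b * (-f) * (lf + lb) ≤ Y * (2 * Y) * X := by
      refine (le_abs_self _).trans ?_
      rw [abs_mul, abs_of_nonneg (mul_nonneg hb hf0)]
      gcongr
    have e3 : (1 - σ) * ((f + b) * B ^ 2) ≤ 1 * (Z * X ^ 2) := by
      have : (f + b) * B ^ 2 ≤ Z * X ^ 2 := by
        calc (f + b) * B ^ 2 ≤ Z * B ^ 2 := by gcongr
          _ ≤ _ := by gcongr
      calc _ ≤ (1 - σ) * (Z * X ^ 2) := mul_le_mul_of_nonneg_left this (by linarith)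
        _ ≤ _ := mul_le_mul_of_nonneg_right (by linarith) (by positivity)
    have e4 : (1 - s) * (b * (2 * (X * Y) + Y ^ 2)) ≤ 1 * (Y * (2 * (X * Y) + Y ^ 2)) := by
      have : b * (2 * (X * Y) + Y ^ 2) ≤ Y * (2 * (X * Y) + Y ^ 2) := by gcongr
      calc _ ≤ (1 - s) * (Y * (2 * (X * Y) + Y ^ 2)) :=
            mul_le_mul_of_nonneg_left this (by linarith)
        _ ≤ _ := mul_le_mul_of_nonneg_right (by linarith) (by positivity)
    have e5 : (s - σ) * (b * B ^ 2) ≤ 6 * K ^ 3 * r ^ (3 * n + 2) := by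
      have : r ^ (3 * n + 3) ≤ r ^ (3 * n + 2) := pow_le_pow_of_le_one hr0 hr1 (by omega)
      have := mul_le_mul_of_nonneg_left this (show 0 ≤ K ^ 3 by positivity)
      calc (s - σ) * (b * B ^ 2) ≤ _ := e1
        _ ≤ Y * (2 * Y) * X + 1 * (Z * X ^ 2) + 1 * (Y * (2 * (X * Y) + Y ^ 2)) :=
          add_le_add (add_le_add e2 e3) e4
        _ = 5 * K ^ 3 * r ^ (3 * n + 2) + K ^ 3 * r ^ (3 * n + 3) := by
          rw [hX, hY, hZ]
          ring
        _ ≤ _ := by linarith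
    have e6 : b * B ^ 2 ≤ (s - σ)⁻¹ * (6 * K ^ 3 * r ^ (3 * n + 2)) := by
      rwa [le_inv_mul_iff₀ hpos]
    calc b ^ 2 * B ^ 2 = b * (b * B ^ 2) := by ring
      _ ≤ Y * ((s - σ)⁻¹ * (6 * K ^ 3 * r ^ (3 * n + 2))) := by gcongr
      _ = (s - σ)⁻¹ * (6 * K ^ 4) * r ^ (4 * n + 3) := by
        rw [hY]
        ring
      _ ≤ _ := by
        rw [add_mul]
        have : 0 ≤ 4 * K ^ 4 * r ^ (4 * n + 3) := by positivity
        linarith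

/-- If `-(-f)^s` and `b^σ` are subharmonic with `σ < s`, there is no cancellation in `f + b`. -/
theorem isBigO_of_add_isBigO_of_power {s σ : ℝ} (hσ0 : 0 ≤ σ) (hσ : σ < s) (hs : s ≤ 1)
    (hf : ContDiffAt ℝ ∞ f 0) (hb : ContDiffAt ℝ ∞ b 0) (hb0 : b 0 = 0)
    (hnonneg : ∀ᶠ ζ in 𝓝 0, 0 ≤ b ζ)
    (hpow : ∀ᶠ ζ in 𝓝 0, (1 - σ) * ‖dolb b ζ 1‖ ^ 2 ≤ b ζ * levi b ζ 1)
    (hneg : ∀ᶠ ζ in 𝓝 0, f ζ < 0 → -(1 - s) * ‖dolb f ζ 1‖ ^ 2 ≤ -f ζ * levi f ζ 1)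
    (hg : (fun ζ => f ζ + b ζ) =O[𝓝 0] fun ζ : ℂ => ‖ζ‖ ^ M) :
    b =O[𝓝 0] fun ζ : ℂ => ‖ζ‖ ^ M := by
  have hgs : ContDiffAt ℝ ∞ (fun ζ => f ζ + b ζ) 0 := hf.add hb
  have hadd : ∀ᶠ ζ in 𝓝 0, levi (fun ζ => f ζ + b ζ) ζ 1 = levi f ζ 1 + levi b ζ 1 ∧
      dolb (fun ζ => f ζ + b ζ) ζ 1 = dolb f ζ 1 + dolb b ζ 1 := by
    filter_upwards [eventually_contDiffAt_two hf, eventually_contDiffAt_two hb] with ζ h1 h2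
    exact ⟨levi_add h1 h2 1, dolb_add (h1.differentiableAt (by norm_num))
      (h2.differentiableAt (by norm_num)) 1⟩
  suffices H : ∀ N ≤ M, b =O[𝓝 0] fun ζ : ℂ => ‖ζ‖ ^ N from H M le_rfl
  intro N
  induction N with
  | zero => exact fun _ => isBigO_one_of_continuousAt hb.continuousAt
  | succ N ih =>
    intro hN
    rcases N with _ | n
    · exact isBigO_one_of_apply_zero hb hb0
    have hbN := ih (by omega)
    have hgN := isBigO_norm_pow_mono hg hN
    have hdb := dolb_isBigO hb hbN
    have hdg := dolb_isBigO hgs hgN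
    have hLg := levi_isBigO hgs hgN
    simp only [Nat.add_sub_cancel, show n + 1 + 1 - 2 = n by omega] at hdb hdg hLg
    obtain ⟨K₁, h1⟩ := hbN.bound
    obtain ⟨K₂, h2⟩ := hgN.bound
    obtain ⟨K₃, h3⟩ := hdb.bound
    obtain ⟨K₄, h4⟩ := hdg.bound
    obtain ⟨K₅, h5⟩ := hLg.bound
    set K : ℝ := max 0 (max K₁ (max K₂ (max K₃ (max K₄ K₅)))) with hK
    have hK0 : 0 ≤ K := le_max_left _ _
    have hk1 : K₁ ≤ K := by simp [hK]
    have hk2 : K₂ ≤ K := by simp [hK]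
    have hk3 : K₃ ≤ K := by simp [hK]
    have hk4 : K₄ ≤ K := by simp [hK]
    have hk5 : K₅ ≤ K := by simp [hK]
    have hpos : 0 < s - σ := by linarith
    set C : ℝ := 4 * K ^ 4 + (s - σ)⁻¹ * (6 * K ^ 4) with hC
    have key : (fun ζ => b ζ ^ 2 * ‖dolb b ζ 1‖ ^ 2) =O[𝓝 0]
        fun ζ : ℂ => ‖ζ‖ ^ (4 * n + 3) := by
      refine IsBigO.of_bound C ?_
      filter_upwards [h1, h2, h3, h4, h5, hadd, hnonneg, hpow, hneg,
        Metric.ball_mem_nhds (0 : ℂ) one_pos] with ζ h1 h2 h3 h4 h5 ha hb hp hn hζ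
      rw [mem_ball_zero_iff] at hζ
      set r := ‖ζ‖ with hr
      have hr0 : 0 ≤ r := norm_nonneg _
      simp only [norm_pow, Real.norm_of_nonneg hr0] at h1 h2 h3 h4 h5 ⊢
      rw [Real.norm_of_nonneg (by positivity)]
      rw [ha.1] at h5
      rw [ha.2] at h4
      rw [Real.norm_of_nonneg hb] at h1
      replace h1 : b ζ ≤ K * r ^ (n + 1) := h1.trans (by gcongr)
      replace h2 : |f ζ + b ζ| ≤ K * r ^ (n + 1 + 1) := h2.trans (by gcongr)
      replace h3 : ‖dolb b ζ 1‖ ≤ K * r ^ n := h3.trans (by gcongr)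
      replace h4 : ‖dolb f ζ 1 + dolb b ζ 1‖ ≤ K * r ^ (n + 1) := h4.trans (by gcongr)
      replace h5 : |levi f ζ 1 + levi b ζ 1| ≤ K * r ^ n := h5.trans (by gcongr)
      exact sq_mul_sq_le_of_power hσ0 hσ hs hr0 hζ.le hK0 hb (norm_nonneg _) h1 h2 h3 h4 h5
        (by simpa using norm_sub_le (dolb f ζ 1 + dolb b ζ 1) (dolb b ζ 1)) (norm_nonneg _) hp hn
    have hsq : ContDiffAt ℝ ∞ (fun ζ => b ζ ^ 2) 0 := hb.pow 2
    -- Integrality is used twice: on the derivative of `b²`, whose square has order `4n + 3 = 2(2n +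
    -- 2) - 1`, and then on `b`, whose square has order `2n + 3 = 2(n + 2) - 1`.
    have hD : fderiv ℝ (fun ζ => b ζ ^ 2) =O[𝓝 0] fun ζ : ℂ => ‖ζ‖ ^ (2 * n + 2) := by
      refine isBigO_of_sq_isBigO (contDiffAt_fderiv hsq) ?_
      rw [show 2 * (2 * n + 2) - 1 = 4 * n + 3 by omega]
      refine IsBigO.trans (IsBigO.of_bound 32 ?_) key
      filter_upwards [eventually_differentiableAt hb] with ζ hζ
      have : fderiv ℝ (fun ζ => b ζ ^ 2) ζ = (2 * b ζ) • fderiv ℝ b ζ := by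
        rw [fderiv_fun_pow 2 hζ]
        simp
      rw [this, norm_smul, mul_pow, Real.norm_of_nonneg (by positivity), Real.norm_eq_abs,
        sq_abs, Real.norm_of_nonneg (by positivity)]
      have := mul_le_mul_of_nonneg_left (norm_sq_fderiv_le b ζ) (sq_nonneg (b ζ))
      nlinarith
    refine isBigO_of_sq_isBigO hb ?_
    have := isBigO_of_fderiv hsq (by simp [hb0]) hD
    rw [show 2 * (n + 1 + 1) - 1 = 2 * n + 2 + 1 by omega]
    simpa using this

end Discs

/-! ### Strict pseudo-convexity near a point -/

section Continuity

variable {V : Type*} [NormedAddCommGroup V] [NormedSpace ℂ V]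

theorem tendsto_clm_apply {α E F : Type*} [NormedAddCommGroup E] [NormedSpace ℝ E]
    [NormedAddCommGroup F] [NormedSpace ℝ F] {l : Filter α} {f : α → E →L[ℝ] F} {g : α → E}
    {f₀ : E →L[ℝ] F} {g₀ : E} (hf : Tendsto f l (𝓝 f₀)) (hg : Tendsto g l (𝓝 g₀)) :
    Tendsto (fun a => f a (g a)) l (𝓝 (f₀ g₀)) :=
  (isBoundedBilinearMap_apply.continuous.tendsto (f₀, g₀)).comp (hf.prodMk_nhds hg)

theorem tendsto_levi {α : Type*} {l : Filter α} {r : V → ℝ} {q t : V} {u v : α → V}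
    (hr : ContDiffAt ℝ ∞ r q) (hu : Tendsto u l (𝓝 q)) (hv : Tendsto v l (𝓝 t)) :
    Tendsto (fun a => levi r (u a) (v a)) l (𝓝 (levi r q t)) := by
  have h : Tendsto (fun a => fderiv ℝ (fderiv ℝ r) (u a)) l (𝓝 (fderiv ℝ (fderiv ℝ r) q)) :=
    (contDiffAt_fderiv (contDiffAt_fderiv hr)).continuousAt.tendsto.comp hu
  have h2 : Tendsto (fun a => Complex.I • v a) l (𝓝 (Complex.I • t)) := hv.const_smul Complex.I
  unfold levi
  exact ((tendsto_clm_apply (tendsto_clm_apply h hv) hv).add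
    (tendsto_clm_apply (tendsto_clm_apply h h2) h2)).div_const 4

theorem tendsto_dolb {α : Type*} {l : Filter α} {r : V → ℝ} {q t : V} {u v : α → V}
    (hr : ContDiffAt ℝ ∞ r q) (hu : Tendsto u l (𝓝 q)) (hv : Tendsto v l (𝓝 t)) :
    Tendsto (fun a => dolb r (u a) (v a)) l (𝓝 (dolb r q t)) := by
  have h : Tendsto (fun a => fderiv ℝ r (u a)) l (𝓝 (fderiv ℝ r q)) :=
    (contDiffAt_fderiv hr).continuousAt.tendsto.comp hu
  have h2 : Tendsto (fun a => Complex.I • v a) l (𝓝 (Complex.I • t)) := hv.const_smul Complex.I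
  simp only [dolb_apply]
  exact tendsto_const_nhds.mul (((Complex.continuous_ofReal.tendsto _).comp
    (tendsto_clm_apply h hv)).sub (tendsto_const_nhds.mul
      ((Complex.continuous_ofReal.tendsto _).comp (tendsto_clm_apply h h2))))
-- Adding a large multiple of `|∂r|²` makes the Levi form positive in every direction at `q`.
-- Continuity extends this to nearby points and directions, and compactness of the unit sphere makes
-- the constants uniform.
theorem exists_levi_add_mul_ge [ProperSpace V] {r : V → ℝ} {q : V} (hr : ContDiffAt ℝ ∞ r q)
    (hpos : ∀ t ≠ 0, dolb r q t = 0 → 0 < levi r q t) :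
    ∃ A c : ℝ, 0 ≤ A ∧ 0 < c ∧
      ∀ᶠ z in 𝓝 q, ∀ t, c * ‖t‖ ^ 2 ≤ levi r z t + A * ‖dolb r z t‖ ^ 2 := by
  have key : ∃ A c : ℝ, 0 ≤ A ∧ 0 < c ∧ ∀ᶠ z in 𝓝 q, ∀ t ∈ Metric.sphere (0 : V) 1,
      c ≤ levi r z t + A * ‖dolb r z t‖ ^ 2 := by
    refine (isCompact_sphere (0 : V) 1).induction_on
      (p := fun S => ∃ A c : ℝ, 0 ≤ A ∧ 0 < c ∧ ∀ᶠ z in 𝓝 q, ∀ t ∈ S,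
        c ≤ levi r z t + A * ‖dolb r z t‖ ^ 2) ?_ ?_ ?_ ?_
    · exact ⟨0, 1, le_rfl, one_pos, by simp⟩
    · rintro S T hST ⟨A, c, hA, hc, h⟩
      exact ⟨A, c, hA, hc, h.mono fun z hz t ht => hz t (hST ht)⟩
    · rintro S T ⟨A, c, hA, hc, h⟩ ⟨A', c', hA', hc', h'⟩
      refine ⟨max A A', min c c', le_max_of_le_left hA, lt_min hc hc', ?_⟩
      filter_upwards [h, h'] with z hz hz' t ht
      rcases ht with ht | ht
      · have := mul_le_mul_of_nonneg_right (le_max_left A A') (sq_nonneg ‖dolb r z t‖)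
        linarith [hz t ht, min_le_left c c']
      · have := mul_le_mul_of_nonneg_right (le_max_right A A') (sq_nonneg ‖dolb r z t‖)
        linarith [hz' t ht, min_le_right c c']
    · intro t ht
      have ht0 : t ≠ 0 := by
        rintro rfl
        simp at ht
      obtain ⟨A, hA, hAt⟩ : ∃ A : ℝ, 0 ≤ A ∧ 0 < levi r q t + A * ‖dolb r q t‖ ^ 2 := by
        by_cases h0 : dolb r q t = 0
        · exact ⟨0, le_rfl, by simpa using hpos t ht0 h0⟩
        · have hD : 0 < ‖dolb r q t‖ ^ 2 := by positivity
          refine ⟨(1 + |levi r q t|) / ‖dolb r q t‖ ^ 2, by positivity, ?_⟩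
          rw [div_mul_cancel₀ _ hD.ne']
          linarith [neg_abs_le (levi r q t)]
      have hlim : Tendsto (fun x : V × V => levi r x.1 x.2 + A * ‖dolb r x.1 x.2‖ ^ 2)
          (𝓝 q ×ˢ 𝓝 t) (𝓝 (levi r q t + A * ‖dolb r q t‖ ^ 2)) :=
        (tendsto_levi hr tendsto_fst tendsto_snd).add
          (((tendsto_dolb hr tendsto_fst tendsto_snd).norm.pow 2).const_mul A)
      have hev := hlim.eventually_const_lt (half_lt_self hAt)
      rw [eventually_prod_iff] at hev
      obtain ⟨p₁, h₁, p₂, h₂, h₁₂⟩ := hev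
      exact ⟨{u | p₂ u}, mem_nhdsWithin_of_mem_nhds h₂, A, _, hA, half_pos hAt,
        h₁.mono fun z hz u hu => (h₁₂ hz hu).le⟩
  obtain ⟨A, c, hA, hc, h⟩ := key
  refine ⟨A, c, hA, hc, h.mono fun z hz t => ?_⟩
  rcases eq_or_ne t 0 with rfl | ht
  · simp
  have hn : 0 < ‖t‖ := norm_pos_iff.2 ht
  have hu := hz (‖t‖⁻¹ • t) (by simp [norm_smul, hn.ne'])
  rw [levi_smul, norm_sq_dolb_smul] at hu
  have := mul_le_mul_of_nonneg_right hu (sq_nonneg ‖t‖)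
  have e : (‖t‖⁻¹ ^ 2 * levi r z t + A * (‖t‖⁻¹ ^ 2 * ‖dolb r z t‖ ^ 2)) * ‖t‖ ^ 2
      = levi r z t + A * ‖dolb r z t‖ ^ 2 := by
    field_simp
  linarith

end Continuity

/-! ### Independence of the defining function; the boundary of `Ω` -/

section DefiningFunctions

/-- Both functions vanish on the same hypersurface. Moving from `x` along a direction `e` in which
`r₂` increases reaches a zero of `r₂` at distance `O(|r₂ x|)`; `r₁` vanishes there too and is
Lipschitz. Neither a quotient of the two functions nor the implicit function theorem is needed. -/
theorem isBigO_of_isLocalDefiningFunction {V : Type*} [NormedAddCommGroup V] [NormedSpace ℂ V]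
    {Ω : Set V} {p : V} {r₁ r₂ : V → ℝ} (h₁ : IsLocalDefiningFunction Ω p r₁)
    (h₂ : IsLocalDefiningFunction Ω p r₂) : r₁ =O[𝓝 p] r₂ := by
  obtain ⟨W₁, hW₁, hp₁, hc₁, hs₁, h0₁, -⟩ := h₁
  obtain ⟨W₂, hW₂, hp₂, hc₂, hs₂, h0₂, hd₂⟩ := h₂
  have hst₁ : HasStrictFDerivAt r₁ (fderiv ℝ r₁ p) p :=
    (hc₁.contDiffAt (hW₁.mem_nhds hp₁)).hasStrictFDerivAt (by simp)
  have hst₂ : HasStrictFDerivAt r₂ (fderiv ℝ r₂ p) p :=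
    (hc₂.contDiffAt (hW₂.mem_nhds hp₂)).hasStrictFDerivAt (by simp)
  obtain ⟨e, he⟩ : ∃ e, 0 < fderiv ℝ r₂ p e := by
    obtain ⟨e, he⟩ : ∃ e, fderiv ℝ r₂ p e ≠ 0 := by
      by_contra! hc
      exact hd₂ (ContinuousLinearMap.ext hc)
    rcases lt_or_gt_of_ne he with h | h
    · exact ⟨-e, by simpa using h⟩
    · exact ⟨e, h⟩
  set d := fderiv ℝ r₂ p e with hd
  have he0 : 0 < ‖e‖ := by
    rw [norm_pos_iff]
    rintro rfl
    simp [hd] at he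
  obtain ⟨C, hC, hL⟩ : ∃ C : ℝ, 0 < C ∧ ∀ᶠ x : V × V in 𝓝 (p, p),
      |r₁ x.1 - r₁ x.2| ≤ C * ‖x.1 - x.2‖ := by
    obtain ⟨C, hC, h⟩ := hst₁.isBigO_sub.exists_pos
    exact ⟨C, hC, by simpa using isBigOWith_iff.1 h⟩
  have hS : ∀ᶠ x : V × V in 𝓝 (p, p),
      |r₂ x.1 - r₂ x.2 - fderiv ℝ r₂ p (x.1 - x.2)| ≤ d / (2 * ‖e‖) * ‖x.1 - x.2‖ := by
    simpa using isLittleO_iff.1 hst₂.isLittleO (show 0 < d / (2 * ‖e‖) by positivity)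
  have hW : ∀ᶠ x in 𝓝 p, x ∈ W₁ ∧ x ∈ W₂ := (hW₁.eventually_mem hp₁).and (hW₂.eventually_mem hp₂)
  obtain ⟨δ, hδ, hball⟩ := Metric.eventually_nhds_iff_ball.1 hW
  obtain ⟨δ', hδ', hball'⟩ := Metric.eventually_nhds_iff_ball.1 (hL.and hS)
  set η := min δ δ' with hη
  have hη0 : 0 < η := lt_min hδ hδ'
  have hcont₂ : ContinuousOn r₂ (Metric.ball p η) := fun x hx =>
    (hc₂.contDiffAt (hW₂.mem_nhds (hball x (Metric.ball_subset_ball (min_le_left _ _) hx)).2)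
      ).continuousAt.continuousWithinAt
  have hcont₁ : ContinuousOn r₁ (Metric.ball p η) := fun x hx =>
    (hc₁.contDiffAt (hW₁.mem_nhds (hball x (Metric.ball_subset_ball (min_le_left _ _) hx)).1)
      ).continuousAt.continuousWithinAt
  have hpair : ∀ x ∈ Metric.ball p η, ∀ y ∈ Metric.ball p η,
      |r₁ x - r₁ y| ≤ C * ‖x - y‖ ∧
        |r₂ x - r₂ y - fderiv ℝ r₂ p (x - y)| ≤ d / (2 * ‖e‖) * ‖x - y‖ := by
    intro x hx y hy
    refine hball' (x, y) ?_
    rw [← ball_prod_same]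
    exact ⟨Metric.ball_subset_ball (min_le_right _ _) hx,
      Metric.ball_subset_ball (min_le_right _ _) hy⟩
  have hslope : ∀ x ∈ Metric.ball p η, ∀ t : ℝ, x + t • e ∈ Metric.ball p η →
      |r₂ (x + t • e) - r₂ x - t * d| ≤ d / 2 * |t| := by
    intro x hx t ht
    have := (hpair _ ht x hx).2
    rw [add_sub_cancel_left, map_smul, smul_eq_mul, norm_smul, Real.norm_eq_abs] at this
    refine this.trans (le_of_eq ?_)
    field_simp
  have hsmall : ∀ᶠ x in 𝓝 p, |r₂ x| < d * η / (4 * ‖e‖) := by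
    have : Tendsto (fun x => |r₂ x|) (𝓝 p) (𝓝 0) := by
      simpa [h0₂] using (hst₂.continuousAt.abs).tendsto
    exact this.eventually_lt_const (by positivity)
  refine IsBigO.of_bound (C * (2 / d) * ‖e‖) ?_
  filter_upwards [hsmall, Metric.ball_mem_nhds p (half_pos hη0)] with x hx hxb
  -- Along `e` the slope of `r₂` is at least `d / 2`, so within parameter distance `τ` it must
  -- change sign.
  set τ := 2 / d * |r₂ x| with hτ
  have hτ0 : 0 ≤ τ := by positivity
  have hτη : τ * ‖e‖ < η / 2 := by
    rw [hτ]
    rw [lt_div_iff₀ (by positivity)] at hx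
    rw [show 2 / d * |r₂ x| * ‖e‖ = 2 * |r₂ x| * ‖e‖ / d by ring, div_lt_iff₀ he]
    linarith
  have hin : ∀ t ∈ Icc (-τ) τ, x + t • e ∈ Metric.ball p η := by
    intro t ht
    have h1 : |t| ≤ τ := abs_le.2 ht
    have h2 : ‖x - p‖ < η / 2 := by simpa [dist_eq_norm] using hxb
    rw [Metric.mem_ball, dist_eq_norm]
    calc ‖x + t • e - p‖ = ‖(x - p) + t • e‖ := by congr 1; abel
      _ ≤ ‖x - p‖ + |t| * ‖e‖ := by
        rw [← Real.norm_eq_abs, ← norm_smul]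
        exact norm_add_le _ _
      _ ≤ ‖x - p‖ + τ * ‖e‖ := by gcongr
      _ < η := by linarith
  have hxη : x ∈ Metric.ball p η := Metric.ball_subset_ball (by linarith) hxb
  have hdτ : d / 2 * τ = |r₂ x| := by
    rw [hτ]
    field_simp
  have hcont : ContinuousOn (fun t : ℝ => r₂ (x + t • e)) (Icc (-τ) τ) :=
    hcont₂.comp (by fun_prop) hin
  have hl : r₂ (x + (-τ) • e) ≤ 0 := by
    have := (abs_le.1 (hslope x hxη (-τ) (hin _ ⟨le_rfl, by linarith⟩))).2
    rw [abs_neg, abs_of_nonneg hτ0] at this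
    linarith [le_abs_self (r₂ x)]
  have hr : 0 ≤ r₂ (x + τ • e) := by
    have := (abs_le.1 (hslope x hxη τ (hin _ ⟨by linarith, le_rfl⟩))).1
    rw [abs_of_nonneg hτ0] at this
    linarith [neg_abs_le (r₂ x)]
  obtain ⟨t, ht, ht0⟩ := intermediate_value_Icc (by linarith) hcont ⟨hl, hr⟩
  set y := x + t • e with hy
  have hyη := hin t ht
  have hmemW : ∀ v ∈ Metric.ball p η, v ∈ W₁ ∧ v ∈ W₂ := fun v hv =>
    hball v (Metric.ball_subset_ball (min_le_left _ _) hv)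
  have hr1 : 0 ≤ r₁ y := by
    by_contra! hlt
    have := (hs₂ y (hmemW y hyη).2).1 ((hs₁ y (hmemW y hyη).1).2 hlt)
    simp only at ht0
    linarith
  -- The points `y + u • e` with `u < 0` lie in `Ω`, so `r₁` is negative there, and it passes to the
  -- limit.
  have hr2 : r₁ y ≤ 0 := by
    have hlim : Tendsto (fun u : ℝ => y + u • e) (𝓝[<] 0) (𝓝 y) := by
      have : ContinuousAt (fun u : ℝ => y + u • e) 0 := by fun_prop
      simpa using this.tendsto.mono_left nhdsWithin_le_nhds
    refine le_of_tendsto ((hcont₁.continuousAt (Metric.isOpen_ball.mem_nhds hyη)).tendsto.comp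
      hlim) ?_
    filter_upwards [hlim.eventually (Metric.isOpen_ball.mem_nhds hyη), self_mem_nhdsWithin]
      with u hu hu0
    have := (abs_le.1 (hslope y hyη u hu)).2
    rw [abs_of_neg hu0] at this
    have hu0' : u < 0 := hu0
    have hneg : r₂ (y + u • e) < 0 := by
      simp only at ht0
      nlinarith
    exact ((hs₁ _ (hmemW _ hu).1).1 ((hs₂ _ (hmemW _ hu).2).2 hneg)).le
  have := (hpair x hxη y hyη).1
  rw [le_antisymm hr2 hr1, sub_zero, hy, sub_add_cancel_left, norm_neg, norm_smul,
    Real.norm_eq_abs] at this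
  rw [Real.norm_eq_abs, Real.norm_eq_abs]
  calc |r₁ x| ≤ C * (|t| * ‖e‖) := this
    _ ≤ C * (τ * ‖e‖) := by
      gcongr
      exact abs_le.2 ht
    _ = _ := by
      rw [hτ]
      ring

variable {V : Type*} [NormedAddCommGroup V] [NormedSpace ℂ V]

/-- A holomorphic map germ of the unit disc with `φ(0) = 0`, possibly zero. -/
def IsDisc₀ (φ : ℂ → V) : Prop :=
  DifferentiableOn ℂ φ (Metric.ball 0 1) ∧ φ 0 = 0

theorem IsDisc.isDisc₀ {φ : ℂ → V} (h : IsDisc φ) : IsDisc₀ φ := ⟨h.1, h.2.1⟩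

theorem IsDisc₀.contDiffAt [CompleteSpace V] {φ : ℂ → V} (h : IsDisc₀ φ) : ContDiffAt ℂ ∞ φ 0 :=
  (h.1.analyticAt (Metric.ball_mem_nhds 0 one_pos)).contDiffAt

theorem IsDisc₀.contDiffAt_real [CompleteSpace V] {φ : ℂ → V} (h : IsDisc₀ φ) :
    ContDiffAt ℝ ∞ φ 0 :=
  h.contDiffAt.restrict_scalars ℝ

theorem IsDisc₀.contDiffAt_comp [CompleteSpace V] {φ : ℂ → V} (h : IsDisc₀ φ) {k : V → ℝ} {z : V}
    (hk : ContDiffAt ℝ ∞ k z) : ContDiffAt ℝ ∞ (fun ζ => k (z + φ ζ)) 0 :=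
  ContDiffAt.comp (𝕜 := ℝ) (g := k) (f := fun ζ => z + φ ζ) 0 (by simpa [h.2] using hk)
    (contDiffAt_const.add h.contDiffAt_real)

theorem IsDisc₀.tendsto [CompleteSpace V] {φ : ℂ → V} (h : IsDisc₀ φ) (z : V) :
    Tendsto (fun ζ => z + φ ζ) (𝓝 0) (𝓝 z) := by
  have h1 : ContinuousAt (fun ζ => z + φ ζ) 0 :=
    continuousAt_const.add h.contDiffAt_real.continuousAt
  have h2 := h1.tendsto
  simp only [h.2, add_zero] at h2
  exact h2

/-- Along every disc the order of `l` is at least that of `k`, while the order of the disc is common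
to both. -/
theorem typ_le_of_isBigO [CompleteSpace V] {k l : V → ℝ} {p : V} (hk : ContDiffAt ℝ ∞ k p)
    (hl : ContDiffAt ℝ ∞ l p) (h : l =O[𝓝 p] k) : typ k p ≤ typ l p := by
  refine iSup₂_mono fun φ hφ => ENNReal.div_le_div_right ?_ _
  rw [ENat.toENNReal_le]
  refine ENat.forall_natCast_le_iff_le.1 fun M hM => ?_
  rw [le_ord₀_iff (hφ.isDisc₀.contDiffAt_comp hk)] at hM
  rw [le_ord₀_iff (hφ.isDisc₀.contDiffAt_comp hl)]
  exact (h.comp_tendsto (hφ.isDisc₀.tendsto p)).trans hM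

theorem IsLocalDefiningFunction.contDiffAt {Ω : Set V} {p : V} {r : V → ℝ}
    (h : IsLocalDefiningFunction Ω p r) : ContDiffAt ℝ ∞ r p := by
  obtain ⟨W, hW, hp, hc, -⟩ := h
  exact hc.contDiffAt (hW.mem_nhds hp)

/-- The type of a boundary point does not depend on the defining function. -/
theorem typ_eq_of_isLocalDefiningFunction [CompleteSpace V] {Ω : Set V} {p : V} {r₁ r₂ : V → ℝ}
    (h₁ : IsLocalDefiningFunction Ω p r₁) (h₂ : IsLocalDefiningFunction Ω p r₂) :
    typ r₁ p = typ r₂ p :=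
  le_antisymm
    (typ_le_of_isBigO h₁.contDiffAt h₂.contDiffAt (isBigO_of_isLocalDefiningFunction h₂ h₁))
    (typ_le_of_isBigO h₂.contDiffAt h₁.contDiffAt (isBigO_of_isLocalDefiningFunction h₁ h₂))

theorem IsDefiningFunction.contDiffAt {Ω U : Set V} {ρ : V → ℝ} (hρ : IsDefiningFunction Ω U ρ)
    {z : V} (hz : z ∈ U) : ContDiffAt ℝ ∞ ρ z :=
  hρ.smooth.contDiffAt (hρ.isOpen.mem_nhds hz)

theorem IsDefiningFunction.neg {Ω U : Set V} {ρ : V → ℝ} (hρ : IsDefiningFunction Ω U ρ)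
    {z : V} (hz : z ∈ Ω) : ρ z < 0 := by
  rw [hρ.eq] at hz
  exact hz.2

theorem IsDefiningFunction.isLocalDefiningFunction {Ω U : Set V} {ρ : V → ℝ}
    (hΩ : IsOpen Ω) (hρ : IsDefiningFunction Ω U ρ) {z : V} (hz : z ∈ frontier Ω) :
    IsLocalDefiningFunction Ω z ρ := by
  have hzU : z ∈ U := hρ.closure_subset hz.1
  refine ⟨U, hρ.isOpen, hzU, hρ.smooth, fun x hx => ?_, ?_, hρ.gradient z hz⟩
  · nth_rw 1 [hρ.eq]
    simp [hx]
  · refine le_antisymm ?_ ?_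
    · have := mem_closure_iff_nhdsWithin_neBot.1 hz.1
      refine le_of_tendsto ((hρ.contDiffAt hzU).continuousAt.tendsto.mono_left
        (nhdsWithin_le_nhds (s := Ω))) ?_
      filter_upwards [self_mem_nhdsWithin] with x hx using (hρ.neg hx).le
    · by_contra! hlt
      have : z ∈ Ω := by
        rw [hρ.eq]
        exact ⟨hzU, hlt⟩
      exact hz.2 (by rwa [hΩ.interior_eq])

/-- The Levi form of `ρ` is nonnegative on the complex tangent space at the boundary points. -/
theorem levi_nonneg_of_mem_closure {Ω : Set V} {ρ : V → ℝ} {s : ℝ}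
    (hs : IsDiederichFornaess Ω ρ s) (hneg : ∀ z ∈ Ω, ρ z < 0) {z : V} (hz : z ∈ closure Ω)
    (hρ : ContDiffAt ℝ ∞ ρ z) (hd : fderiv ℝ ρ z ≠ 0) {t : V} (ht : dolb ρ z t = 0) :
    0 ≤ levi ρ z t := by
  obtain ⟨e, he⟩ := dolb_ne_zero hd
  have hcd : ∀ t, Tendsto (fun y => dolb ρ y t) (𝓝 z) (𝓝 (dolb ρ z t)) := fun t =>
    tendsto_dolb (u := fun y => y) hρ tendsto_id tendsto_const_nhds
  -- Projecting `t` along `e` into the complex tangent space of the level set through a nearby `y ∈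
  -- Ω`, where the curvature inequality applies.
  have hT : Tendsto (fun y => t - (dolb ρ y t / dolb ρ y e) • e) (𝓝 z) (𝓝 t) := by
    have h1 : Tendsto (fun y => dolb ρ y t / dolb ρ y e) (𝓝 z) (𝓝 0) := by
      have := (hcd t).div (hcd e) he
      rwa [ht, zero_div] at this
    have h2 := (tendsto_const_nhds (x := t)).sub (h1.smul_const e)
    rwa [zero_smul, sub_zero] at h2
  have hlim := tendsto_levi (u := fun y => y) hρ tendsto_id hT
  have hnb : (𝓝[Ω] z).NeBot := mem_closure_iff_nhdsWithin_neBot.1 hz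
  refine ge_of_tendsto (hlim.mono_left (nhdsWithin_le_nhds (s := Ω))) ?_
  filter_upwards [self_mem_nhdsWithin, nhdsWithin_le_nhds ((hcd e).eventually_ne he),
    nhdsWithin_le_nhds (eventually_contDiffAt_two hρ)] with y hy hye hyc
  have hu0 : dolb ρ y (t - (dolb ρ y t / dolb ρ y e) • e) = 0 := by
    rw [map_sub, map_smul, smul_eq_mul, div_mul_cancel₀ _ hye, sub_self]
  generalize t - (dolb ρ y t / dolb ρ y e) • e = u at hu0 ⊢
  by_cases h0 : u = 0
  · rw [h0, levi_zero_right]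
  · have h1 := hs.levi_gt hy hyc (hneg y hy) h0
    rw [hu0, norm_zero, zero_pow two_ne_zero, mul_zero] at h1
    have h2 := hneg y hy
    exact (pos_of_mul_pos_right h1 (by linarith)).le

end DefiningFunctions

/-! ### Types in terms of integer orders -/

section Types

theorem toENNReal_le_of_forall_nat {x : ℕ∞} {y : ℝ≥0∞} (h : ∀ M : ℕ, (M : ℕ∞) ≤ x → (M : ℝ≥0∞) ≤ y) :
    (x : ℝ≥0∞) ≤ y := by
  induction x using ENat.recTopCoe with
  | top =>
    rw [ENNReal.eq_top_of_forall_nnreal_le (x := y) fun r => ?_]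
    · exact le_top
    · obtain ⟨M, hM⟩ := exists_nat_ge r
      exact le_trans (by exact_mod_cast hM) (h M le_top)
  | coe M => simpa using h M le_rfl

variable {V W : Type*} [NormedAddCommGroup V] [NormedSpace ℂ V]
  [NormedAddCommGroup W] [NormedSpace ℂ W]

theorem IsDisc₀.comp_clm {φ : ℂ → V} (h : IsDisc₀ φ) (A : V →L[ℂ] W) :
    IsDisc₀ fun ζ => A (φ ζ) :=
  ⟨A.differentiable.comp_differentiableOn h.1, by simp [h.2]⟩

variable [CompleteSpace V] [CompleteSpace W]

theorem ord₀_comp_of_norm {A : V →L[ℂ] W} (hA : ∀ v, ‖A v‖ = ‖v‖) {φ : ℂ → V} (hφ : IsDisc₀ φ) :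
    ord₀ (fun ζ => A (φ ζ)) = ord₀ φ := by
  refine ENat.eq_of_forall_natCast_le_iff fun M => ?_
  rw [le_ord₀_iff (hφ.comp_clm A).contDiffAt_real, le_ord₀_iff hφ.contDiffAt_real,
    ← isBigO_norm_left, ← isBigO_norm_left (f' := φ)]
  simp only [hA]

/-- A norm-preserving linear map carries discs to discs of the same order; with the inclusions of
the factors this gives the lower bounds on types. -/
theorem typ_le_typ_of_norm {A : V →L[ℂ] W} (hA : ∀ v, ‖A v‖ = ‖v‖) {k : V → ℝ} {l : W → ℝ} {p : V}
    {q : W} (h : ∀ v, l (q + A v) = k (p + v)) : typ k p ≤ typ l q := by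
  refine iSup₂_le fun φ hφ => ?_
  have hd : IsDisc fun ζ => A (φ ζ) := by
    obtain ⟨ζ, hζ, hne⟩ := hφ.2.2
    refine ⟨(hφ.isDisc₀.comp_clm A).1, (hφ.isDisc₀.comp_clm A).2, ζ, hζ, fun h0 => hne ?_⟩
    rw [← norm_eq_zero, ← hA, show A (φ ζ) = 0 from h0, norm_zero]
  refine le_iSup₂_of_le (fun ζ => A (φ ζ)) hd (le_of_eq ?_)
  simp only [h, ord₀_comp_of_norm hA hφ.isDisc₀]

theorem one_le_ord₀ {φ : ℂ → V} (hφ : IsDisc₀ φ) : 1 ≤ ord₀ φ := by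
  have := (le_ord₀_iff (N := 1) hφ.contDiffAt_real).2
    (isBigO_of_fderiv (N := 0) hφ.contDiffAt_real hφ.2
      (isBigO_one_of_continuousAt (contDiffAt_fderiv hφ.contDiffAt_real).continuousAt))
  simpa using this

/-- The failure of `O(‖ζ‖ ^ (ν + 1))` encodes order at most `ν` and also forces `φ` to be a non-zero
disc, so it can be applied to components of a disc, some of which may vanish identically. -/
theorem natCast_le_typ_mul {k : V → ℝ} {z : V} (hk : ContDiffAt ℝ ∞ k z) {φ : ℂ → V}
    (hφ : IsDisc₀ φ) {M ν : ℕ} (hM : (fun ζ => k (z + φ ζ)) =O[𝓝 0] fun ζ : ℂ => ‖ζ‖ ^ M)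
    (hν : ¬ φ =O[𝓝 0] fun ζ : ℂ => ‖ζ‖ ^ (ν + 1)) : (M : ℝ≥0∞) ≤ typ k z * ν := by
  have hd : IsDisc φ := by
    refine ⟨hφ.1, hφ.2, ?_⟩
    by_contra! hc
    refine hν (IsBigO.of_bound 1 ?_)
    filter_upwards [Metric.ball_mem_nhds (0 : ℂ) one_pos] with ζ hζ
    rw [hc ζ hζ, norm_zero]
    positivity
  have h1 : ord₀ φ ≤ ν := by
    rw [← not_lt, ← ENat.add_one_le_iff (by simp)]
    exact fun h => hν ((le_ord₀_iff hφ.contDiffAt_real).1 (by exact_mod_cast h))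
  have h2 : (M : ℕ∞) ≤ ord₀ fun ζ => k (z + φ ζ) := (le_ord₀_iff (hφ.contDiffAt_comp hk)).2 hM
  have h3 : (ord₀ (fun ζ => k (z + φ ζ)) : ℝ≥0∞) / (ord₀ φ : ℝ≥0∞) ≤ typ k z :=
    le_iSup₂_of_le φ hd le_rfl
  have h4 : (ord₀ φ : ℝ≥0∞) ≠ 0 := by
    have := one_le_ord₀ hφ
    intro h0
    rw [ENat.toENNReal_eq_zero] at h0
    simp [h0] at this
  have h5 : (ord₀ φ : ℝ≥0∞) ≤ ν := by exact_mod_cast ENat.toENNReal_le.2 h1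
  have h6 : (ord₀ φ : ℝ≥0∞) ≠ ⊤ := (h5.trans_lt (by simp)).ne
  rw [ENNReal.div_le_iff h4 h6] at h3
  calc (M : ℝ≥0∞) ≤ (ord₀ (fun ζ => k (z + φ ζ)) : ℝ≥0∞) := by
        exact_mod_cast ENat.toENNReal_le.2 h2
    _ ≤ typ k z * (ord₀ φ : ℝ≥0∞) := h3
    _ ≤ _ := by gcongr

theorem typ_le_of_forall {r : V → ℝ} {q : V} {T : ℝ≥0∞} (hr : ContDiffAt ℝ ∞ r q)
    (h : ∀ γ : ℂ → V, IsDisc₀ γ → ∀ M ν : ℕ,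
      ((fun ζ => r (q + γ ζ)) =O[𝓝 0] fun ζ : ℂ => ‖ζ‖ ^ M) →
        (¬ γ =O[𝓝 0] fun ζ : ℂ => ‖ζ‖ ^ (ν + 1)) → (M : ℝ≥0∞) ≤ T * ν) : typ r q ≤ T := by
  refine iSup₂_le fun γ hγ => ?_
  rcases eq_or_ne (ord₀ γ) ⊤ with htop | htop
  · simp [htop]
  obtain ⟨ν, hν⟩ := ENat.ne_top_iff_exists.1 htop
  refine ENNReal.div_le_of_le_mul (toENNReal_le_of_forall_nat fun M hM => ?_)
  rw [← hν, ENat.toENNReal_coe]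
  refine h γ hγ.isDisc₀ M ν ((le_ord₀_iff (hγ.isDisc₀.contDiffAt_comp hr)).1 hM) fun hO => ?_
  have := (le_ord₀_iff hγ.isDisc₀.contDiffAt_real).2 hO
  rw [← hν, Nat.cast_le] at this
  omega

/-- A complex line has order 1, while `h` restricted to it has a critical zero at the minimum, hence
order at least 2. -/
theorem two_le_typ [Nontrivial V] {h : V → ℝ} (hs : ContDiff ℝ ∞ h) (hn : ∀ w, 0 ≤ h w)
    (h0 : h 0 = 0) : 2 ≤ typ h 0 := by
  obtain ⟨v, hv⟩ := exists_ne (0 : V)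
  have hφ : IsDisc₀ fun ζ : ℂ => ζ • v := ⟨by fun_prop, by simp⟩
  have hb := hφ.contDiffAt_comp (z := 0) (hs.contDiffAt (x := 0))
  have hb0 : (fun ζ : ℂ => h (0 + ζ • v)) 0 = 0 := by simp [h0]
  have hD : fderiv ℝ (fun ζ : ℂ => h (0 + ζ • v)) 0 = 0 :=
    IsLocalMin.fderiv_eq_zero (Filter.Eventually.of_forall fun ζ => by
      rw [hb0]
      exact hn _)
  have h2 : (fun ζ : ℂ => h (0 + ζ • v)) =O[𝓝 0] fun ζ : ℂ => ‖ζ‖ ^ 2 :=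
    isBigO_of_fderiv hb hb0 (isBigO_of_fderiv (N := 0) (contDiffAt_fderiv hb) hD
      (isBigO_one_of_continuousAt (contDiffAt_fderiv (contDiffAt_fderiv hb)).continuousAt))
  have hν : ¬ (fun ζ : ℂ => ζ • v) =O[𝓝 0] fun ζ : ℂ => ‖ζ‖ ^ (1 + 1) := by
    intro hO
    have hlim : Tendsto (fun x : ℝ => (x : ℂ)) (𝓝[≠] 0) (𝓝 0) := by
      simpa using (Complex.continuous_ofReal.tendsto 0).mono_left nhdsWithin_le_nhds
    obtain ⟨C, hC⟩ := (hO.comp_tendsto hlim).bound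
    have hsm : ∀ᶠ x : ℝ in 𝓝[≠] 0, C * |x| < ‖v‖ := by
      have : Tendsto (fun x : ℝ => C * |x|) (𝓝[≠] 0) (𝓝 0) := by
        have := ((continuous_abs.tendsto (0 : ℝ)).const_mul C).mono_left
          (nhdsWithin_le_nhds (s := {0}ᶜ))
        simpa using this
      exact this.eventually_lt_const (norm_pos_iff.2 hv)
    obtain ⟨x, ⟨h3, h4⟩, h5⟩ := ((hC.and hsm).and self_mem_nhdsWithin).exists
    have hx : 0 < |x| := abs_pos.2 h5
    simp only [Function.comp_apply, norm_smul, Complex.norm_real, Real.norm_eq_abs, norm_pow,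
      abs_abs] at h3
    have h6 := mul_lt_mul_of_pos_left h4 hx
    have h7 : C * |x| ^ (1 + 1) = |x| * (C * |x|) := by ring
    linarith
  simpa using natCast_le_typ_mul hs.contDiffAt hφ h2 hν

theorem IsDisc₀.levi_comp {φ : ℂ → V} (hφ : IsDisc₀ φ) {k : V → ℝ} {z : V}
    (hk : ContDiffAt ℝ ∞ k z) : ∀ᶠ ζ in 𝓝 0,
      levi (fun ζ => k (z + φ ζ)) ζ 1 = levi k (z + φ ζ) (fderiv ℂ φ ζ 1) ∧
        dolb (fun ζ => k (z + φ ζ)) ζ 1 = dolb k (z + φ ζ) (fderiv ℂ φ ζ 1) := by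
  filter_upwards [(hφ.contDiffAt.of_le (m := 2) ENat.LEInfty.out).eventually (by simp),
    (hφ.tendsto z).eventually (eventually_contDiffAt_two hk)] with ζ h1 h2
  have h3 : ContDiffAt ℂ 2 (fun ζ => z + φ ζ) ζ := contDiffAt_const.add h1
  constructor
  · rw [Hartogs.levi_comp (γ := fun ζ => z + φ ζ) h2 h3, fderiv_const_add]
  · rw [dolb_comp (γ := fun ζ => z + φ ζ) (h2.differentiableAt (by norm_num))
      (h3.differentiableAt (by norm_num)), fderiv_const_add]

end Types

/-! ### The function `ρ(z) + h(w)` and its domain -/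

section Product

variable {E F : Type*} [NormedAddCommGroup E] [NormedSpace ℂ E] [NormedAddCommGroup F]
  [NormedSpace ℂ F]

theorem contDiffAt_comp_clm {V : Type*} [NormedAddCommGroup V] [NormedSpace ℂ V] {n : ℕ∞ω}
    {k : E → ℝ} (A : V →L[ℂ] E) {z : V} (hk : ContDiffAt ℝ n k (A z)) :
    ContDiffAt ℝ n (fun y => k (A y)) z :=
  hk.comp z (A.contDiff.contDiffAt.restrict_scalars ℝ)

/-- The function `ρ(z) + h(w)`. -/
def prodFun (ρ : E → ℝ) (h : F → ℝ) (x : E × F) : ℝ := ρ x.1 + h x.2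

variable {ρ : E → ℝ} {h : F → ℝ} {q : E × F}

theorem contDiffAt_prodFun {n : ℕ∞ω} (hρ : ContDiffAt ℝ n ρ q.1) (hh : ContDiffAt ℝ n h q.2) :
    ContDiffAt ℝ n (prodFun ρ h) q :=
  (contDiffAt_comp_clm (ContinuousLinearMap.fst ℂ E F) hρ).add
    (contDiffAt_comp_clm (ContinuousLinearMap.snd ℂ E F) hh)

theorem levi_prodFun (hρ : ContDiffAt ℝ ∞ ρ q.1) (hh : ContDiffAt ℝ ∞ h q.2) (t : E × F) :
    levi (prodFun ρ h) q t = levi ρ q.1 t.1 + levi h q.2 t.2 := by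
  have hρ2 : ContDiffAt ℝ 2 ρ q.1 := hρ.of_le ENat.LEInfty.out
  have hh2 : ContDiffAt ℝ 2 h q.2 := hh.of_le ENat.LEInfty.out
  have := levi_add (contDiffAt_comp_clm (ContinuousLinearMap.fst ℂ E F) (z := q) hρ2)
    (contDiffAt_comp_clm (ContinuousLinearMap.snd ℂ E F) (z := q) hh2) t
  rwa [levi_comp_clm (ContinuousLinearMap.fst ℂ E F) hρ2,
    levi_comp_clm (ContinuousLinearMap.snd ℂ E F) hh2] at this

theorem dolb_prodFun (hρ : ContDiffAt ℝ ∞ ρ q.1) (hh : ContDiffAt ℝ ∞ h q.2) (t : E × F) :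
    dolb (prodFun ρ h) q t = dolb ρ q.1 t.1 + dolb h q.2 t.2 := by
  have hρ2 := contDiffAt_comp_clm (ContinuousLinearMap.fst ℂ E F) (z := q) hρ
  have hh2 := contDiffAt_comp_clm (ContinuousLinearMap.snd ℂ E F) (z := q) hh
  have := dolb_add (hρ2.differentiableAt (by simp)) (hh2.differentiableAt (by simp)) t
  rwa [dolb_comp_clm (ContinuousLinearMap.fst ℂ E F) (hρ.differentiableAt (by simp)),
    dolb_comp_clm (ContinuousLinearMap.snd ℂ E F) (hh.differentiableAt (by simp))] at this

theorem fderiv_prodFun_ne_zero (hρ : ContDiffAt ℝ ∞ ρ q.1) (hh : ContDiffAt ℝ ∞ h q.2)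
    (hd : fderiv ℝ ρ q.1 ≠ 0 ∨ fderiv ℝ h q.2 ≠ 0) : fderiv ℝ (prodFun ρ h) q ≠ 0 := by
  intro h0
  have h1 := fun t => dolb_prodFun hρ hh t
  rw [dolb_zero h0] at h1
  rcases hd with hd | hd
  · obtain ⟨t, ht⟩ := dolb_ne_zero hd
    exact ht (by simpa using (h1 (t, 0)).symm)
  · obtain ⟨t, ht⟩ := dolb_ne_zero hd
    exact ht (by simpa using (h1 (0, t)).symm)

variable {Ω U : Set E} {s : ℝ}

theorem isLocalDefiningFunction_tilde (hρ : IsDefiningFunction Ω U ρ) (hh : ContDiff ℝ ∞ h)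
    (hq : q.1 ∈ U) (h0 : ρ q.1 + h q.2 = 0) (hd : fderiv ℝ ρ q.1 ≠ 0 ∨ fderiv ℝ h q.2 ≠ 0) :
    IsLocalDefiningFunction (tilde U ρ h) q (prodFun ρ h) := by
  refine ⟨Prod.fst ⁻¹' U, hρ.isOpen.preimage continuous_fst, hq, fun x hx => ?_, fun x hx => ?_,
    h0, fderiv_prodFun_ne_zero (hρ.contDiffAt hq) hh.contDiffAt hd⟩
  · exact (contDiffAt_prodFun (hρ.contDiffAt hx) hh.contDiffAt).contDiffWithinAt
  · have : x.1 ∈ U := hx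
    simp [tilde, prodFun, this]

/-- Since `h ≥ 0`, the Hartogs domain lies over `Ω`, so its closure lies over the closure of `Ω`.
The boundary of `U` therefore contributes no boundary points. -/
theorem mem_closure_of_mem_frontier_tilde (hρ : IsDefiningFunction Ω U ρ) (hh : ContDiff ℝ ∞ h)
    (hn : ∀ w, 0 ≤ h w) (hq : q ∈ frontier (tilde U ρ h)) :
    q.1 ∈ closure Ω ∧ q.1 ∈ U ∧ ρ q.1 + h q.2 = 0 := by
  have hsub : tilde U ρ h ⊆ Prod.fst ⁻¹' Ω := by
    rintro x ⟨hx, hlt⟩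
    have := hn x.2
    rw [mem_preimage, hρ.eq]
    exact ⟨hx, by linarith⟩
  have hcl : q.1 ∈ closure Ω := continuous_fst.closure_preimage_subset _ (closure_mono hsub hq.1)
  have hU := hρ.closure_subset hcl
  have hc : ContinuousAt (prodFun ρ h) q :=
    (contDiffAt_prodFun (hρ.contDiffAt hU) hh.contDiffAt).continuousAt
  refine ⟨hcl, hU, le_antisymm ?_ ?_⟩
  · have := mem_closure_iff_nhdsWithin_neBot.1 hq.1
    refine le_of_tendsto (hc.tendsto.mono_left (nhdsWithin_le_nhds (s := tilde U ρ h))) ?_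
    filter_upwards [self_mem_nhdsWithin] with x hx using hx.2.le
  · by_contra! hlt
    refine hq.2 (mem_interior_iff_mem_nhds.2 ?_)
    filter_upwards [(hρ.isOpen.preimage continuous_fst).mem_nhds hU,
      hc.eventually_lt_const hlt] with x h1 h2 using ⟨h1, h2⟩

theorem IsDefiningFunction.mem_of_neg (hρ : IsDefiningFunction Ω U ρ) {z : E} (hz : z ∈ U)
    (h : ρ z < 0) : z ∈ Ω := by
  rw [hρ.eq]
  exact ⟨hz, h⟩

theorem levi_prodFun_pos (hρ : IsDefiningFunction Ω U ρ) (hs : IsDiederichFornaess Ω ρ s)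
    (hh : ContDiff ℝ ∞ h) {σ : ℝ} (hσ : σ < s) (hU : q.1 ∈ U) (h0 : ρ q.1 + h q.2 = 0)
    (hpos : 0 < h q.2) (hpow : ∀ u, (1 - σ) * ‖dolb h q.2 u‖ ^ 2 ≤ h q.2 * levi h q.2 u)
    (hstrict : ∀ u ≠ 0, 0 < levi h q.2 u) {t : E × F} (ht : t ≠ 0)
    (htan : dolb (prodFun ρ h) q t = 0) : 0 < levi (prodFun ρ h) q t := by
  have hΩ : q.1 ∈ Ω := hρ.mem_of_neg hU (by linarith)
  have hc := hρ.contDiffAt hU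
  rw [levi_prodFun hc hh.contDiffAt]
  rw [dolb_prodFun hc hh.contDiffAt] at htan
  refine levi_add_levi_pos hσ (fun t ht => hs.levi_gt hΩ (hc.of_le ENat.LEInfty.out)
    (hρ.neg hΩ) ht) hpos (hpow _) (hstrict _) h0 htan ?_
  by_contra! hcon
  exact ht (Prod.ext hcon.1 hcon.2)

theorem isStrictPseudoconvexAt_tilde (hρ : IsDefiningFunction Ω U ρ)
    (hs : IsDiederichFornaess Ω ρ s) (hh : ContDiff ℝ ∞ h) (hn : ∀ w, 0 ≤ h w)
    {σ : ℝ} (hσ : σ < s) (hq : q ∈ frontier (tilde U ρ h)) (hpos : 0 < h q.2)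
    (hgrad : fderiv ℝ h q.2 ≠ 0)
    (hpow : ∀ u, (1 - σ) * ‖dolb h q.2 u‖ ^ 2 ≤ h q.2 * levi h q.2 u)
    (hstrict : ∀ u ≠ 0, 0 < levi h q.2 u) : IsStrictPseudoconvexAt (tilde U ρ h) q := by
  obtain ⟨-, hU, h0⟩ := mem_closure_of_mem_frontier_tilde hρ hh hn hq
  exact ⟨_, isLocalDefiningFunction_tilde hρ hh hU h0 (Or.inr hgrad), fun t ht hne =>
    levi_prodFun_pos hρ hs hh hσ hU h0 hpos hpow hstrict hne (dolb_eq_zero_iff.2 ht)⟩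

theorem isPseudoconvex_tilde (hρ : IsDefiningFunction Ω U ρ)
    (hs : IsDiederichFornaess Ω ρ s) (hh : ContDiff ℝ ∞ h) (hn : ∀ w, 0 ≤ h w)
    {σ : ℝ} (hσ : σ < s) (hgrad : ∀ w, 0 < h w → fderiv ℝ h w ≠ 0)
    (hpow : ∀ w u, (1 - σ) * ‖dolb h w u‖ ^ 2 ≤ h w * levi h w u)
    (hpsh : ∀ w u, 0 ≤ levi h w u) : IsPseudoconvex (tilde U ρ h) := by
  intro q hq
  obtain ⟨hcl, hU, h0⟩ := mem_closure_of_mem_frontier_tilde hρ hh hn hq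
  have hc := hρ.contDiffAt hU
  rcases (hn q.2).eq_or_lt with hz | hpos
  · have hfr : q.1 ∈ frontier Ω := by
      refine ⟨hcl, fun hi => ?_⟩
      have := hρ.neg (interior_subset hi)
      linarith
    have hg := hρ.gradient _ hfr
    refine ⟨_, isLocalDefiningFunction_tilde hρ hh hU h0 (Or.inl hg), fun t ht => ?_⟩
    rw [← dolb_eq_zero_iff, dolb_prodFun hc hh.contDiffAt,
      dolb_zero (fderiv_eq_zero_of_nonneg hn hz.symm), zero_apply, add_zero] at ht
    rw [levi_prodFun hc hh.contDiffAt]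
    exact add_nonneg (levi_nonneg_of_mem_closure hs (fun z hz => hρ.neg hz) hcl hc hg ht)
      (hpsh _ _)
  · have hqΩ : q.1 ∈ Ω := hρ.mem_of_neg hU (by linarith)
    refine ⟨_, isLocalDefiningFunction_tilde hρ hh hU h0 (Or.inr (hgrad _ hpos)), fun t ht => ?_⟩
    rw [← dolb_eq_zero_iff, dolb_prodFun hc hh.contDiffAt] at ht
    rw [levi_prodFun hc hh.contDiffAt]
    exact levi_add_levi_nonneg hσ (fun t ht => hs.levi_gt hqΩ (hc.of_le ENat.LEInfty.out)
      (hρ.neg hqΩ) ht) hpos (hpow _ _) (hpsh _ _) h0 ht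

theorem typ_prodFun [CompleteSpace E] [CompleteSpace F] (hρ : IsDefiningFunction Ω U ρ)
    (hs : IsDiederichFornaess Ω ρ s) {σ : ℝ} (hσ0 : 0 ≤ σ) (hσ : σ < s) (hh : IsAdmissible h)
    (hpow : ∀ w u, (1 - σ) * ‖dolb h w u‖ ^ 2 ≤ h w * levi h w u) {z : E} (hz : z ∈ U)
    (hz0 : ρ z = 0) : typ (prodFun ρ h) (z, 0) = max (typ ρ z) (typ h 0) := by
  have hc := hρ.contDiffAt hz
  have hc0 : ContDiffAt ℝ ∞ h 0 := hh.smooth.contDiffAt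
  refine le_antisymm (typ_le_of_forall (contDiffAt_prodFun hc hc0) ?_) (max_le ?_ ?_)
  · intro γ hγ M ν hM hν
    have hφ := hγ.comp_clm (ContinuousLinearMap.fst ℂ E F)
    have hψ := hγ.comp_clm (ContinuousLinearMap.snd ℂ E F)
    simp only [ContinuousLinearMap.coe_fst', ContinuousLinearMap.coe_snd'] at hφ hψ
    have hM' : (fun ζ => ρ (z + (γ ζ).1) + h (0 + (γ ζ).2)) =O[𝓝 0] fun ζ : ℂ => ‖ζ‖ ^ M := hM
    have hb : (fun ζ => h (0 + (γ ζ).2)) =O[𝓝 0] fun ζ : ℂ => ‖ζ‖ ^ M := by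
      refine isBigO_of_add_isBigO_of_power hσ0 hσ hs.le_one (hφ.contDiffAt_comp hc)
        (hψ.contDiffAt_comp hc0) (by simp [hψ.2, hh.apply_zero])
        (Eventually.of_forall fun ζ => hh.nonneg _) ?_ ?_ hM'
      · filter_upwards [hψ.levi_comp hc0] with ζ h1
        rw [h1.1, h1.2]
        exact hpow _ _
      · filter_upwards [hφ.levi_comp hc, (hφ.tendsto z).eventually (hρ.isOpen.mem_nhds hz)]
          with ζ h1 h2 h3
        rw [h1.1, h1.2]
        -- The curvature inequality for `ρ` is strict and excludes the zero vector, for which both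
        -- sides vanish.
        by_cases h4 : fderiv ℂ (fun ζ => (γ ζ).1) ζ 1 = 0
        · simp [h4]
        · exact (hs.levi_gt (hρ.mem_of_neg h2 h3)
            ((hρ.contDiffAt h2).of_le ENat.LEInfty.out) h3 h4).le
    have hf : (fun ζ => ρ (z + (γ ζ).1)) =O[𝓝 0] fun ζ : ℂ => ‖ζ‖ ^ M := by
      simpa using hM'.sub hb
    -- The order of the disc is attained by one of its two components, and that component is tested
    -- against its own function.
    by_cases h1 : (fun ζ => (γ ζ).1) =O[𝓝 0] fun ζ : ℂ => ‖ζ‖ ^ (ν + 1)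
    · have h2 : ¬ (fun ζ => (γ ζ).2) =O[𝓝 0] fun ζ : ℂ => ‖ζ‖ ^ (ν + 1) := fun h2 =>
        hν (h1.prod_left h2)
      refine (natCast_le_typ_mul hc0 hψ hb h2).trans ?_
      gcongr
      exact le_max_right _ _
    · refine (natCast_le_typ_mul hc hφ hf h1).trans ?_
      gcongr
      exact le_max_left _ _
  · exact typ_le_typ_of_norm (A := ContinuousLinearMap.inl ℂ E F) (by simp)
      fun v => by simp [prodFun, hh.apply_zero]
  · exact typ_le_typ_of_norm (A := ContinuousLinearMap.inr ℂ E F) (by simp)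
      fun v => by simp [prodFun, hz0]

end Product

/-! ### Separated sums and condition II -/

section Sums

/-- The function `∑ h_i(w_i)` for an arbitrary finite index set. -/
def sepSum {ι : Type*} [Fintype ι] {F : ι → Type*} (h : ∀ i, F i → ℝ) (w : ∀ i, F i) : ℝ :=
  ∑ i, h i (w i)

theorem sepSum_nonneg {ι : Type*} [Fintype ι] {F : ι → Type*} {h : ∀ i, F i → ℝ}
    (hn : ∀ i w, 0 ≤ h i w) (w : ∀ i, F i) : 0 ≤ sepSum h w :=
  Finset.sum_nonneg fun i _ => hn i (w i)

variable {ι : Type*} [Fintype ι] {F : ι → Type*} [∀ i, NormedAddCommGroup (F i)]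
  [∀ i, NormedSpace ℂ (F i)] {h : ∀ i, F i → ℝ}

theorem contDiff_sepSum (hh : ∀ i, ContDiff ℝ ∞ (h i)) : ContDiff ℝ ∞ (sepSum h) :=
  contDiff_iff_contDiffAt.2 fun _ => ContDiffAt.sum fun i _ =>
    contDiffAt_comp_clm (ContinuousLinearMap.proj (R := ℂ) (φ := F) i) (hh i).contDiffAt

theorem levi_sepSum (hh : ∀ i, ContDiff ℝ ∞ (h i)) (w u : ∀ i, F i) :
    levi (sepSum h) w u = ∑ i, levi (h i) (w i) (u i) := by
  have h2 : ∀ i, ContDiff ℝ 2 (h i) := fun i => (hh i).of_le ENat.LEInfty.out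
  refine (levi_sum Finset.univ (fun i _ => contDiffAt_comp_clm
    (ContinuousLinearMap.proj (R := ℂ) (φ := F) i) (h2 i).contDiffAt) u).trans ?_
  exact Finset.sum_congr rfl fun i _ =>
    levi_comp_clm (ContinuousLinearMap.proj (R := ℂ) (φ := F) i) (h2 i).contDiffAt u

theorem dolb_sepSum (hh : ∀ i, ContDiff ℝ ∞ (h i)) (w u : ∀ i, F i) :
    dolb (sepSum h) w u = ∑ i, dolb (h i) (w i) (u i) := by
  refine (dolb_sum Finset.univ (fun i _ => (contDiffAt_comp_clm
    (ContinuousLinearMap.proj (R := ℂ) (φ := F) i)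
      (hh i).contDiffAt).differentiableAt (by simp)) u).trans ?_
  exact Finset.sum_congr rfl fun i _ =>
    dolb_comp_clm (ContinuousLinearMap.proj (R := ℂ) (φ := F) i)
      ((hh i).contDiffAt.differentiableAt (by simp)) u

theorem norm_sq_dolb_sepSum_le (hh : ∀ i, ContDiff ℝ ∞ (h i)) (hn : ∀ i w, 0 ≤ h i w)
    (hpsh : ∀ i w u, 0 ≤ levi (h i) w u)
    (hlog : ∀ i w u, ‖dolb (h i) w u‖ ^ 2 ≤ h i w * levi (h i) w u) (w u : ∀ i, F i) :
    ‖dolb (sepSum h) w u‖ ^ 2 ≤ sepSum h w * levi (sepSum h) w u := by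
  rw [levi_sepSum hh, dolb_sepSum hh]
  exact norm_sq_sum_le _ (fun i => hn i (w i)) (fun i => hpsh i _ _) fun i => hlog i _ _

theorem levi_sepSum_pos (hh : ∀ i, ContDiff ℝ ∞ (h i)) (hpsh : ∀ i w u, 0 ≤ levi (h i) w u)
    {w : ∀ i, F i} (hstrict : ∀ i, ∀ u ≠ 0, 0 < levi (h i) (w i) u) (u : ∀ i, F i) (hu : u ≠ 0) :
    0 < levi (sepSum h) w u := by
  rw [levi_sepSum hh]
  obtain ⟨i, hi⟩ := Function.ne_iff.1 hu
  exact Finset.sum_pos' (fun i _ => hpsh i _ _) ⟨i, Finset.mem_univ _, hstrict i _ hi⟩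

theorem fderiv_sepSum_ne_zero (hh : ∀ i, ContDiff ℝ ∞ (h i))
    {w : ∀ i, F i} {i : ι} (hi : fderiv ℝ (h i) (w i) ≠ 0) : fderiv ℝ (sepSum h) w ≠ 0 := by
  classical
  intro h0
  obtain ⟨t, ht⟩ := dolb_ne_zero hi
  have h1 := dolb_sepSum hh w (Pi.single i t)
  rw [dolb_zero h0, Finset.sum_eq_single i (fun j _ hj => by simp [hj]) (by simp)] at h1
  exact ht (by simpa using h1.symm)

theorem sepSum_pos_iff (hh : ∀ i, IsAdmissible (h i)) {w : ∀ i, F i} :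
    0 < sepSum h w ↔ w ≠ 0 := by
  constructor
  · rintro hpos rfl
    simp [sepSum, (hh _).apply_zero] at hpos
  · intro hw
    obtain ⟨i, hi⟩ := Function.ne_iff.1 hw
    exact Finset.sum_pos' (fun i _ => (hh i).nonneg _) ⟨i, Finset.mem_univ _, (hh i).pos hi⟩

theorem fderiv_sepSum_ne_zero_of_ne (hh : ∀ i, IsAdmissible (h i)) {w : ∀ i, F i} (hw : w ≠ 0) :
    fderiv ℝ (sepSum h) w ≠ 0 := by
  obtain ⟨i, hi⟩ := Function.ne_iff.1 hw
  exact fderiv_sepSum_ne_zero (fun i => (hh i).smooth) ((hh i).gradient _ hi)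

variable {E : Type*} [NormedAddCommGroup E] [NormedSpace ℂ E] {Ω U : Set E} {ρ : E → ℝ} {s : ℝ}

theorem typ_prodFun_sepSum [ProperSpace E] [∀ i, ProperSpace (F i)] [∀ i, Nontrivial (F i)]
    (hρ : IsDefiningFunction Ω U ρ) (hs : IsDiederichFornaess Ω ρ s)
    (hh : ∀ i, IsAdmissible (h i)) (hpsh : ∀ i w u, 0 ≤ levi (h i) w u)
    (hlog : ∀ i w u, ‖dolb (h i) w u‖ ^ 2 ≤ h i w * levi (h i) w u)
    (hstrict : ∀ i, ∀ w ≠ 0, ∀ u ≠ 0, 0 < levi (h i) w u) {q : E × ∀ i, F i} (hU : q.1 ∈ U)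
    (h0 : ρ q.1 + sepSum h q.2 = 0) (hq : q.2 ≠ 0) (hex : ∃ i, q.2 i = 0) :
    typ (prodFun ρ (sepSum h)) q = ⨆ (i : ι) (_ : q.2 i = 0), typ (h i) 0 := by
  classical
  have hsm : ∀ i, ContDiff ℝ ∞ (h i) := fun i => (hh i).smooth
  have hc := hρ.contDiffAt hU
  have hc0 : ContDiffAt ℝ ∞ (sepSum h) q.2 := (contDiff_sepSum hsm).contDiffAt
  refine le_antisymm (typ_le_of_forall (contDiffAt_prodFun hc hc0) ?_) (iSup₂_le fun i hi => ?_)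
  swap
  · refine typ_le_typ_of_norm (A := (ContinuousLinearMap.inr ℂ E (∀ i, F i)).comp
      (ContinuousLinearMap.single ℂ F i)) (by simp [Pi.norm_single]) fun v => ?_
    have h1 : sepSum h (q.2 + Pi.single i v) = sepSum h q.2 + h i v := by
      rw [sepSum, sepSum, ← Finset.add_sum_erase _ _ (Finset.mem_univ i),
        ← Finset.add_sum_erase _ (fun j => h j (q.2 j)) (Finset.mem_univ i)]
      have : ∀ j ∈ Finset.univ.erase i, h j ((q.2 + Pi.single i v) j) = h j (q.2 j) := by
        intro j hj
        simp [Finset.ne_of_mem_erase hj]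
      rw [Finset.sum_congr rfl this]
      simp [hi, (hh i).apply_zero]
      ring
    simp only [prodFun, ContinuousLinearMap.comp_apply, ContinuousLinearMap.inr_apply,
      ContinuousLinearMap.single_apply, Prod.fst_add, Prod.snd_add, add_zero, zero_add]
    rw [h1]
    linarith
  intro γ hγ M ν hM hν
  set T := ⨆ (i : ι) (_ : q.2 i = 0), typ (h i) 0 with hT
  have htyp : ∀ i, q.2 i = 0 → typ (h i) 0 ≤ T := fun i hi =>
    le_iSup₂ (f := fun (i : ι) (_ : q.2 i = 0) => typ (h i) 0) i hi
  have hT2 : 2 ≤ T := by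
    obtain ⟨i, hi⟩ := hex
    exact (two_le_typ (hsm i) (hh i).nonneg (hh i).apply_zero).trans (htyp i hi)
  -- the components with nonzero and with zero base point
  let RJ : E × (∀ i, F i) →L[ℂ] E × (∀ j : {i // ¬ q.2 i = 0}, F j) :=
    (ContinuousLinearMap.fst ℂ _ _).prod (ContinuousLinearMap.pi fun j =>
      (ContinuousLinearMap.proj (R := ℂ) (φ := F) j.1).comp (ContinuousLinearMap.snd ℂ _ _))
  let R0 : E × (∀ i, F i) →L[ℂ] (∀ j : {i // q.2 i = 0}, F j) :=
    ContinuousLinearMap.pi fun j =>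
      (ContinuousLinearMap.proj (R := ℂ) (φ := F) j.1).comp (ContinuousLinearMap.snd ℂ _ _)
  let hJ : ∀ j : {i // ¬ q.2 i = 0}, F j → ℝ := fun j => h j
  let hI : ∀ j : {i // q.2 i = 0}, F j → ℝ := fun j => h j
  have hsplit : ∀ w : ∀ i, F i, sepSum h w = sepSum hI (fun j => w j) + sepSum hJ fun j => w j :=
    fun w => (Fintype.sum_subtype_add_sum_subtype (fun i => q.2 i = 0) fun i => h i (w i)).symm
  have hI0 : sepSum hI (fun j => q.2 j) = 0 :=
    Finset.sum_eq_zero fun j _ => by simp [hI, j.2, (hh _).apply_zero]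
  have hqJ : (RJ q).2 ≠ 0 := by
    obtain ⟨i, hi⟩ := Function.ne_iff.1 hq
    exact fun h => hi (congrFun h ⟨i, hi⟩)
  have h0J : ρ (RJ q).1 + sepSum hJ (RJ q).2 = 0 := by
    have := hsplit q.2
    rw [hI0, zero_add] at this
    exact (congrArg (ρ q.1 + ·) this.symm).trans h0
  have hsmJ : ∀ j, ContDiff ℝ ∞ (hJ j) := fun j => hsm j
  have hsmI : ∀ j, ContDiff ℝ ∞ (hI j) := fun j => hsm j
  have hnI : ∀ w, 0 ≤ sepSum hI w := sepSum_nonneg fun j => (hh j).nonneg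
  have hcJ : ContDiffAt ℝ ∞ (prodFun ρ (sepSum hJ)) (RJ q) :=
    contDiffAt_prodFun hc (contDiff_sepSum hsmJ).contDiffAt
  have hcI : ContDiffAt ℝ ∞ (sepSum hI) 0 := (contDiff_sepSum hsmI).contDiffAt
  obtain ⟨A, c, hA, hcpos, hest⟩ := exists_levi_add_mul_ge hcJ fun t ht htan =>
    levi_prodFun_pos (σ := 0) hρ hs (contDiff_sepSum hsmJ) hs.pos hU h0J
      ((sepSum_pos_iff (h := hJ) fun j => hh j).2 hqJ)
      (fun u => by
        simpa using norm_sq_dolb_sepSum_le hsmJ (fun j => (hh j).nonneg) (fun j => hpsh j)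
          (fun j => hlog j) _ u)
      (levi_sepSum_pos hsmJ (fun j => hpsh j) fun j => hstrict j _ j.2) ht htan
  have hγJ := hγ.comp_clm RJ
  have hγ0 := hγ.comp_clm R0
  have hM' : (fun ζ => prodFun ρ (sepSum hJ) (RJ q + RJ (γ ζ)) + sepSum hI (0 + R0 (γ ζ)))
      =O[𝓝 0] fun ζ : ℂ => ‖ζ‖ ^ M := by
    refine hM.congr_left fun ζ => ?_
    have h2 : (fun j : {i // q.2 i = 0} => (q.2 + (γ ζ).2) j) = 0 + R0 (γ ζ) := by
      ext j
      simp [R0, j.2]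
    have h3 : (fun j : {i // ¬ q.2 i = 0} => (q.2 + (γ ζ).2) j) = (RJ q + RJ (γ ζ)).2 := rfl
    change ρ (q.1 + (γ ζ).1) + sepSum h (q.2 + (γ ζ).2) = _
    rw [hsplit, h2, h3, prodFun]
    change _ = ρ (q.1 + (γ ζ).1) + _ + _
    ring
  obtain ⟨hb, hord⟩ := isBigO_of_add_isBigO_of_strict (hγJ.contDiffAt_comp hcJ)
    (hγ0.contDiffAt_comp hcI) hγJ.contDiffAt
    (by
      have h1 : R0 (γ 0) = 0 := hγ0.2
      rw [h1, add_zero]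
      exact Finset.sum_eq_zero fun j _ => (hh j).apply_zero)
    hγJ.2 hA hcpos (Eventually.of_forall fun ζ => hnI _)
    (by
      filter_upwards [hγ0.levi_comp hcI] with ζ h1
      rw [h1.1, h1.2]
      exact norm_sq_dolb_sepSum_le hsmI (fun j => (hh j).nonneg) (fun j => hpsh j)
        (fun j => hlog j) _ _)
    (by
      filter_upwards [hγJ.levi_comp hcJ, (hγJ.tendsto (RJ q)).eventually hest] with ζ h1 h2
      rw [h1.1, h1.2]
      exact h2 _)
    hM'
  -- If the strictly pseudo-convex part of the disc has order above `ν`, some component with zero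
  -- base point has order at most `ν`, and its `h_i` is bounded by the nonnegative sum `b = O(‖ζ‖ ^
  -- M)`.
  by_cases hJO : (fun ζ => RJ (γ ζ)) =O[𝓝 0] fun ζ : ℂ => ‖ζ‖ ^ (ν + 1)
  · obtain ⟨i, hi, hiO⟩ : ∃ i, q.2 i = 0 ∧
        ¬ (fun ζ => (γ ζ).2 i) =O[𝓝 0] fun ζ : ℂ => ‖ζ‖ ^ (ν + 1) := by
      by_contra! hcon
      refine hν (IsBigO.prod_left (f' := fun ζ => (γ ζ).1) (g' := fun ζ => (γ ζ).2) ?_ ?_)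
      · exact (isBigO_fst_prod (f' := fun ζ => (RJ (γ ζ)).1)
          (g' := fun ζ => (RJ (γ ζ)).2)).trans hJO
      · refine isBigO_pi.2 fun i => ?_
        by_cases hi : q.2 i = 0
        · exact hcon i hi
        · exact isBigO_pi.1 ((isBigO_snd_prod (f' := fun ζ => (RJ (γ ζ)).1)
            (g' := fun ζ => (RJ (γ ζ)).2)).trans hJO) ⟨i, hi⟩
    have hdi : IsDisc₀ fun ζ => (γ ζ).2 i :=
      hγ.comp_clm ((ContinuousLinearMap.proj (R := ℂ) (φ := F) i).comp
        (ContinuousLinearMap.snd ℂ _ _))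
    have hbi : (fun ζ => h i (0 + (γ ζ).2 i)) =O[𝓝 0] fun ζ : ℂ => ‖ζ‖ ^ M := by
      refine IsBigO.trans (IsBigO.of_bound 1 (Eventually.of_forall fun ζ => ?_)) hb
      rw [one_mul, Real.norm_of_nonneg ((hh i).nonneg _),
        Real.norm_of_nonneg (hnI _)]
      have := Finset.single_le_sum (f := fun j : {i // q.2 i = 0} => hI j ((0 + R0 (γ ζ)) j))
        (fun j _ => (hh j).nonneg _) (Finset.mem_univ ⟨i, hi⟩)
      exact this
    refine (natCast_le_typ_mul (hsm i).contDiffAt hdi hbi hiO).trans ?_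
    gcongr
    exact htyp i hi
  -- Otherwise strictness bounds the contact order by `2ν`, and `2 ≤ T`.
  · have hlt : M ≤ 2 * ν := by
      by_contra! hlt
      exact hJO (hord (ν + 1) (by omega))
    calc (M : ℝ≥0∞) ≤ ((2 * ν : ℕ) : ℝ≥0∞) := by exact_mod_cast hlt
      _ = 2 * (ν : ℝ≥0∞) := by push_cast; rfl
      _ ≤ T * ν := by gcongr

end Sums

end Hartogs

/-! ### The main theorem -/

theorem mainTheorem7 (n : ℕ) (Ω U : Set (Hartogs.Cn n)) (ρ : Hartogs.Cn n → ℝ) (s : ℝ)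
    (hΩ : Hartogs.IsSmoothBoundedPseudoconvexDomain Ω)
    (hρ : Hartogs.IsDefiningFunction Ω U ρ)
    (hs : Hartogs.IsDiederichFornaess Ω ρ s) :
    (∀ (m : ℕ) (h : Hartogs.Cn m → ℝ), Hartogs.ConditionI s h →
      (∀ z₀ ∈ frontier Ω, ∀ τ : ℝ≥0∞, Hartogs.IsOfFiniteType Ω z₀ τ → Hartogs.typ h 0 < ⊤ →
        Hartogs.IsOfFiniteType (Hartogs.tilde U ρ h) (z₀, 0) (max τ (Hartogs.typ h 0))) ∧
      (Hartogs.IsStrictPSHOn h {0}ᶜ →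
        ∀ q ∈ frontier (Hartogs.tilde U ρ h), q.2 ≠ 0 →
          Hartogs.IsStrictPseudoconvexAt (Hartogs.tilde U ρ h) q)) ∧
    (∀ (p : ℕ) (m : Fin p → ℕ) (h : ∀ i, Hartogs.Cn (m i) → ℝ), Hartogs.ConditionII h →
      Hartogs.IsPseudoconvex (Hartogs.tilde U ρ (Hartogs.sumFun h)) ∧
      ∀ q ∈ frontier (Hartogs.tilde U ρ (Hartogs.sumFun h)),
        q.2 ≠ 0 →
          ((∃ i, q.2 i = 0) →
            Hartogs.IsOfFiniteType (Hartogs.tilde U ρ (Hartogs.sumFun h)) q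
              (⨆ (i : Fin p) (_ : q.2 i = 0), Hartogs.typ (h i) 0)) ∧
          ((∀ i, q.2 i ≠ 0) →
            Hartogs.IsStrictPseudoconvexAt (Hartogs.tilde U ρ (Hartogs.sumFun h)) q)) := by
  open Hartogs in
  refine ⟨fun m h hI => ?_, fun p m h hII => ?_⟩
  · obtain ⟨hadm, σ, hσ0, hσ, hp⟩ := hI
    have hpow := hp.norm_sq_dolb_le hadm hσ0
    refine ⟨fun z₀ hz₀ τ hτ hfin => ?_, fun hstrict q hq hne => ?_⟩
    · obtain ⟨hτ, r, hr, rfl⟩ := hτ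
      have hloc := hρ.isLocalDefiningFunction hΩ.isOpen hz₀
      have hU := hρ.closure_subset hz₀.1
      have h0 : ρ z₀ = 0 := by
        obtain ⟨-, -, -, -, -, h0, -⟩ := hloc
        exact h0
      refine ⟨max_lt hτ hfin, prodFun ρ h, isLocalDefiningFunction_tilde hρ hadm.smooth hU
        (by simp [h0, hadm.apply_zero]) (Or.inl (hρ.gradient _ hz₀)), ?_⟩
      rw [typ_prodFun hρ hs hσ0 hσ hadm hpow hU h0, typ_eq_of_isLocalDefiningFunction hloc hr]
    · exact isStrictPseudoconvexAt_tilde hρ hs hadm.smooth hadm.nonneg hσ hq (hadm.pos hne)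
        (hadm.gradient _ hne) (hpow _) (hstrict.2 _ hne)
  · have hsm : ∀ i, ContDiff ℝ ∞ (h i) := fun i => (hII.admissible i).smooth
    have hn : ∀ i w, 0 ≤ h i w := fun i => (hII.admissible i).nonneg
    have hpsh : ∀ i w u, 0 ≤ levi (h i) w u := fun i w => (hII.psh i).2 w (mem_univ w)
    have hlog : ∀ i w u, ‖dolb (h i) w u‖ ^ 2 ≤ h i w * levi (h i) w u := by
      intro i w u
      -- Condition II enters as the exponent `σ = 0`, admissible since `0 < s`.
      have hp : PowerIsPSH (h i) 0 := by simpa [PowerIsPSH] using hII.log_psh i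
      simpa using hp.norm_sq_dolb_le (hII.admissible i) le_rfl w u
    have hpow : ∀ w u, (1 - 0) * ‖dolb (sumFun h) w u‖ ^ 2 ≤ sumFun h w * levi (sumFun h) w u := by
      intro w u
      rw [sub_zero, one_mul]
      exact norm_sq_dolb_sepSum_le hsm hn hpsh hlog w u
    have hsmS : ContDiff ℝ ∞ (sumFun h) := contDiff_sepSum hsm
    have hnS : ∀ w, 0 ≤ sumFun h w := sepSum_nonneg hn
    refine ⟨isPseudoconvex_tilde hρ hs hsmS hnS hs.pos (fun w hw =>
      fderiv_sepSum_ne_zero_of_ne hII.admissible ((sepSum_pos_iff hII.admissible).1 hw)) hpow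
      fun w u => ?_, fun q hq hne => ⟨fun hex => ?_, fun hall => ?_⟩⟩
    · exact (levi_sepSum hsm w u).symm ▸ Finset.sum_nonneg fun i _ => hpsh i _ _
    · obtain ⟨-, hU, h0⟩ := mem_closure_of_mem_frontier_tilde hρ hsmS hnS hq
      have hnt : ∀ i, Nontrivial (Cn (m i)) := fun i => by
        have : NeZero (m i) := ⟨by have := hII.dim_pos i; omega⟩
        infer_instance
      refine ⟨?_, _, isLocalDefiningFunction_tilde hρ hsmS hU h0
        (Or.inr (fderiv_sepSum_ne_zero_of_ne hII.admissible hne)),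
        typ_prodFun_sepSum hρ hs hII.admissible hpsh hlog (fun i => (hII.strictPSH i).2) hU h0
          hne hex⟩
      -- A supremum of finitely many finite types is finite; an inner supremum over a false
      -- condition is 0.
      rw [← Finset.sup_univ_eq_iSup, Finset.sup_lt_iff (by simp)]
      exact fun i _ => (iSup_le fun _ => le_rfl).trans_lt (hII.finiteType i)
    · exact isStrictPseudoconvexAt_tilde hρ hs hsmS hnS hs.pos hq
        ((sepSum_pos_iff hII.admissible).2 hne) (fderiv_sepSum_ne_zero_of_ne hII.admissible hne)
        (hpow _) (levi_sepSum_pos hsm hpsh fun i => (hII.strictPSH i).2 _ (hall i))
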